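/- Let $M$ be a smooth manifold (finite-dimensional, Hausdorff, $\sigma$-compact) with a smooth involution $\tau$, regarded as an action of $\mathbb Z_2$. A $\mathbb Z_2$-sheaf is a sheaf of abelian groups on $M$ with an action of $\mathbb Z_2$ covering that on $M$; for such a sheaf $\mathcal S$ let $H^p(M;\mathbb Z_2,\mathcal S)$ be Grothendieck's equivariant sheaf cohomology (the right derived functors of the functor of invariant global sections) and $H^p(M,\mathcal S)$ the ordinary sheaf cohomology of the underlying sheaf. Let $\mathcal U(1)$ be the sheaf of smooth $U(1)$-valued functions with $\tau$ acting by $f\mapsto f\circ\tau$, let $\overline{\mathcal U(1)}$ be the same sheaf with $\tau$ acting by $f\mapsto \bar f\circ\tau$, and let $\mathbb Z$ be the sheaf of locally constant integer functions with $\tau$ acting by $f\mapsto f\circ\tau$. Let $\mathcal U(1)\oplus\tau^{-1}\mathcal U(1)$ carry the $\mathbb Z_2$-action that interchanges the summands. The following homomorphisms are isomorphisms: the connecting homomorphisms of the exponential sequence $0\to\mathbb Z\to\mathbb R\to\mathcal U(1)\to 0$ (smooth real functions in the middle, map $f\mapsto e^{2\pi i f}$), $$\varphi\colon H^2(M,\mathcal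 U(1))\to H^3(M,\mathbb Z),\qquad \psi\colon H^2(M;\mathbb Z_2,\mathcal U(1))\to H^3(M;\mathbb Z_2,\mathbb Z),$$ and the homomorphism $$e\colon H^2(M;\mathbb Z_2,\mathcal U(1)\oplus\tau^{-1}\mathcal U(1))\to H^2(M,\mathcal U(1))$$ that forgets equivariance and projects to the first summand. Let $$1\times\tau^*\colon H^2(M,\mathcal U(1))\to H^2(M;\mathbb Z_2,\mathcal U(1))$$ be the composition of $e^{-1}$ with the map induced by the morphism of $\mathbb Z_2$-sheaves $\mathcal U(1)\oplus\tau^{-1}\mathcal U(1)\to\mathcal U(1)$, $(g,h)\mapsto g\,(h\circ\tau)$. Let $[H]\in H^3(M,\mathbb Z)$ be the quantum flux (Dixmier--Douady class) of a $B$-field on $M$. The $B$-field is an orientifold $B$-field, i.e. $[H]+\tau^*[H]=0$ in $H^3(M,\mathbb Z)$ and $[H]$ lifts to a class in $H^2(M;\mathbb Z_2,\overline{\mathcal U(1)})$ (it is the image of such a class under the map $H^2(M;\mathbb Z_2,\overline{\mathcal U(1)})\to H^2(M,\mathcal U(1))\xrightarrow{\varphi}H^3(M,\mathbb Z)$ that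 forgets the Real structure), if and only if $(1\times\tau^*)\varphi^{-1}[H]=0$ in $H^2(M;\mathbb Z_2,\mathcal U(1))$, equivalently if and only if $\psi\big((1\times\tau^*)\varphi^{-1}[H]\big)=0$ in the integral equivariant cohomology $H^3(M;\mathbb Z_2,\mathbb Z)$. -/

import Mathlib

open CategoryTheory Opposite TopologicalSpace Abelian
open scoped Manifold ContDiff

universe u

noncomputable section

namespace RealGerbe

/-! ### Real manifolds -/

/-- A smooth involution `τ : M → M`; the pair `(M, τ)` is a Real manifold. -/
structure SmoothInvolution {E : Type*} [NormedAddCommGroup E] [NormedSpace ℝ E]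
    {H : Type*} [TopologicalSpace H] (I : ModelWithCorners ℝ E H)
    (M : Type u) [TopologicalSpace M] [ChartedSpace H M] where
  toFun : M → M
  contMDiff : ContMDiff I I ∞ toFun
  involutive : Function.Involutive toFun

namespace SmoothInvolution

variable {E : Type*} [NormedAddCommGroup E] [NormedSpace ℝ E]
  {H : Type*} [TopologicalSpace H] {I : ModelWithCorners ℝ E H}
  {M : Type u} [TopologicalSpace M] [ChartedSpace H M] (τ : SmoothInvolution I M)

/-- The action of `ℤ/2` on `M` given by the involution: `0` acts as the identity, `1` as `τ`. -/
def act (g : ZMod 2) (x : M) : M := if g = 0 then x else τ.toFun x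

@[simp] lemma act_zero (x : M) : τ.act 0 x = x := rfl

lemma act_add (g h : ZMod 2) (x : M) : τ.act (g + h) x = τ.act g (τ.act h x) := by
  have hx := τ.involutive x
  have h2 : ∀ k : ZMod 2, k = 0 ∨ k = 1 := by decide
  have h11 : (1 : ZMod 2) + 1 = 0 := by decide
  obtain rfl | rfl := h2 g <;> obtain rfl | rfl := h2 h <;> simp [act, h11, hx]

lemma contMDiff_act (g : ZMod 2) : ContMDiff I I ∞ (τ.act g) := by
  unfold act
  split_ifs
  · exact contMDiff_id
  · exact τ.contMDiff

end SmoothInvolution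

/-! ### The equivariant site -/

section Site

variable {E : Type*} [NormedAddCommGroup E] [NormedSpace ℝ E]
  {H : Type*} [TopologicalSpace H] {I : ModelWithCorners ℝ E H}
  {M : Type u} [TopologicalSpace M] [ChartedSpace H M]

/-- The open subsets of `M`, as objects of the category whose morphisms `U ⟶ V` are the
elements `g` of `ℤ/2` with `g U ⊆ V`.  A presheaf on this category is a presheaf `F` on `M`
with isomorphisms `F(τ U) ≅ F(U)` (action of `τ`), involutive and compatible with restriction. -/
structure EqOpens (τ : SmoothInvolution I M) : Type u where
  toOpens : Opens M

namespace EqOpens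

variable {τ : SmoothInvolution I M}

/-- A morphism `U ⟶ V`: an element `g` of `ℤ/2` that maps `U` into `V`. -/
@[ext] structure Hom (U V : EqOpens τ) : Type u where
  label : ZMod 2
  mapsTo : ∀ x ∈ U.toOpens, τ.act label x ∈ V.toOpens

instance : SmallCategory (EqOpens τ) where
  Hom := Hom
  id U := ⟨0, fun _ hx => hx⟩
  comp f g := ⟨g.label + f.label, fun x hx => by
    rw [τ.act_add]; exact g.mapsTo _ (f.mapsTo x hx)⟩
  id_comp f := Hom.ext (add_zero _)
  comp_id f := Hom.ext (zero_add _)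
  assoc f g h := Hom.ext (add_assoc _ _ _).symm

@[ext] lemma hom_ext {U V : EqOpens τ} {f g : U ⟶ V} (h : f.label = g.label) : f = g :=
  Hom.ext h

@[simp] lemma id_label (U : EqOpens τ) : Hom.label (𝟙 U) = 0 := rfl

@[simp] lemma comp_label {U V W : EqOpens τ} (f : U ⟶ V) (g : V ⟶ W) :
    Hom.label (f ≫ g) = g.label + f.label := rfl

variable (τ) in
/-- The functor from the category of open subsets of `M` (with inclusions): inclusions are the
morphisms labelled by `0`. -/
def incl : Opens M ⥤ EqOpens τ where
  obj U := ⟨U⟩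
  map f := ⟨0, fun _ hx => f.le hx⟩

variable (τ) in
/-- A sieve on `U` is covering if the open subsets `V ⊆ U` whose inclusion into `U` belongs to
it cover `U`.  A sheaf of abelian groups for this topology is a `ℤ/2`-sheaf on `M`: a sheaf of
abelian groups with an action of `ℤ/2` covering that on `M`. -/
def topology : GrothendieckTopology (EqOpens τ) where
  sieves U := {S | ∀ x ∈ U.toOpens, ∃ (V : Opens M) (h : V ≤ U.toOpens),
    x ∈ V ∧ S ((incl τ).map (homOfLE h))}
  top_mem' U x hx := ⟨U.toOpens, le_rfl, hx, trivial⟩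
  pullback_stable' U Y S k hS y hy := by
    obtain ⟨V, hV, hyV, hSV⟩ := hS _ (k.mapsTo y hy)
    refine ⟨⟨τ.act k.label ⁻¹' V, V.isOpen.preimage (τ.contMDiff_act k.label).continuous⟩ ⊓
      Y.toOpens, inf_le_right, ⟨hyV, hy⟩, ?_⟩
    let j : (incl τ).obj (⟨τ.act k.label ⁻¹' V,
        V.isOpen.preimage (τ.contMDiff_act k.label).continuous⟩ ⊓ Y.toOpens) ⟶ (incl τ).obj V :=
      ⟨k.label, fun x hx => hx.1⟩
    have := S.downward_closed hSV j
    have e : j ≫ (incl τ).map (homOfLE hV) = (incl τ).map (homOfLE inf_le_right) ≫ k := by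
      apply hom_ext
      change 0 + k.label = k.label + 0
      simp
    change S.arrows ((incl τ).map (homOfLE inf_le_right) ≫ k)
    exact e ▸ this
  transitive' U S hS R hR x hx := by
    obtain ⟨V, hV, hxV, hSV⟩ := hS x hx
    obtain ⟨W, hW, hxW, hRW⟩ := hR hSV x hxV
    refine ⟨W, hW.trans hV, hxW, ?_⟩
    convert! hRW using 1

instance : (incl τ).IsCocontinuous (Opens.grothendieckTopology M) (topology τ) where
  cover_lift {U S} hS x hx := by
    obtain ⟨V, hV, hxV, hSV⟩ := hS x hx
    exact ⟨V, homOfLE hV, hSV, hxV⟩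

instance : (incl τ).IsContinuous (Opens.grothendieckTopology M) (topology τ) := by
  apply Functor.isContinuous_of_coverPreserving
  · constructor
    intro F Z T x hx Y₁ Y₂ X f₁ f₂ g₁ g₂ hg₁ hg₂ h
    have hl : Hom.label f₁ = Hom.label f₂ := by
      have h' := congrArg Hom.label h
      rw [comp_label, comp_label] at h'
      simpa [incl] using h'
    let W : Opens M := Y₁ ⊓ Y₂
    let k : X ⟶ (incl τ).obj W := ⟨Hom.label f₁, fun y hy => ⟨f₁.mapsTo y hy, by
      rw [hl]; exact f₂.mapsTo y hy⟩⟩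
    have e₁ : f₁ = k ≫ (incl τ).map (homOfLE inf_le_left) := hom_ext (by simp [k, incl])
    have e₂ : f₂ = k ≫ (incl τ).map (homOfLE inf_le_right) := hom_ext (by simp [k, incl, hl])
    have hc := hx (homOfLE inf_le_left : W ⟶ Y₁) (homOfLE inf_le_right : W ⟶ Y₂) hg₁ hg₂
      (Subsingleton.elim _ _)
    rw [e₁, e₂, op_comp, op_comp, F.obj.map_comp, F.obj.map_comp]
    exact congrArg (F.obj.map k.op) hc
  · constructor
    intro U S hS x hx
    obtain ⟨V, f, hf, hxV⟩ := hS x hx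
    exact ⟨V, f.le, hxV, ⟨V, f, 𝟙 _, hf, by simp; rfl⟩⟩

end EqOpens

/-- The category of `ℤ/2`-sheaves (of abelian groups) on the Real manifold `(M, τ)`. -/
abbrev Z2Sheaf (τ : SmoothInvolution I M) : Type (u + 1) :=
  Sheaf (EqOpens.topology τ) AddCommGrpCat.{u}

/-- The category of sheaves of abelian groups on `M`. -/
abbrev AbSheaf (M : Type u) [TopologicalSpace M] : Type (u + 1) :=
  Sheaf (Opens.grothendieckTopology M) AddCommGrpCat.{u}

/-- The underlying sheaf on `M` of a `ℤ/2`-sheaf, forgetting the action. -/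
abbrev forgetAction (τ : SmoothInvolution I M) : Z2Sheaf τ ⥤ AbSheaf M :=
  (EqOpens.incl τ).sheafPushforwardContinuous AddCommGrpCat.{u}
    (Opens.grothendieckTopology M) (EqOpens.topology τ)

instance (τ : SmoothInvolution I M) : (forgetAction τ).IsRightAdjoint :=
  ((EqOpens.incl τ).sheafAdjunctionContinuous AddCommGrpCat.{u} _ _).isRightAdjoint

instance (τ : SmoothInvolution I M) : (forgetAction τ).IsLeftAdjoint :=
  ((EqOpens.incl τ).sheafAdjunctionCocontinuous AddCommGrpCat.{u} _ _).isLeftAdjoint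

instance (τ : SmoothInvolution I M) : (forgetAction τ).Additive where

end Site

/-! ### Sheaf cohomology and its functoriality -/

section Cohomology

variable {C D : Type u} [SmallCategory C] [SmallCategory D] {J : GrothendieckTopology C}
  {K : GrothendieckTopology D} (G : C ⥤ D) [G.IsContinuous J K]

instance additive_sheafPushforwardContinuous :
    (G.sheafPushforwardContinuous AddCommGrpCat.{u} J K).Additive where

/-- The canonical morphism from the constant sheaf to the restriction, along a continuous functor
of sites, of the constant sheaf. -/
def constComparison (A : AddCommGrpCat.{u}) :
    (constantSheaf J AddCommGrpCat.{u}).obj A ⟶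
      (G.sheafPushforwardContinuous AddCommGrpCat.{u} J K).obj
        ((constantSheaf K AddCommGrpCat.{u}).obj A) :=
  ((sheafificationAdjunction J AddCommGrpCat.{u}).homEquiv _ _).symm
    (Functor.whiskerLeft G.op (toSheafify K ((Functor.const Dᵒᵖ).obj A)))

/-- For a continuous functor of sites whose restriction functor on abelian sheaves is exact, the
induced map `Hⁿ(D, F) → Hⁿ(C, F|_C)`; in degree `0` it sends a global section to its restriction. -/
def cohomologyRestrict
    [Limits.PreservesFiniteLimits (G.sheafPushforwardContinuous AddCommGrpCat.{u} J K)]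
    [Limits.PreservesFiniteColimits (G.sheafPushforwardContinuous AddCommGrpCat.{u} J K)]
    (F : Sheaf K AddCommGrpCat.{u}) (n : ℕ) :
    Sheaf.H F n →+ Sheaf.H ((G.sheafPushforwardContinuous AddCommGrpCat.{u} J K).obj F) n :=
  ((Ext.mk₀ (constComparison (J := J) (K := K) G (AddCommGrpCat.of (ULift ℤ)))).precomp
      _ (zero_add n)).comp
    ((G.sheafPushforwardContinuous AddCommGrpCat.{u} J K).mapExtAddHom _ F n)

/-- The connecting homomorphism `Hⁿ(S₃) → Hⁿ⁺¹(S₁)` of a short exact sequence of abelian sheaves. -/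
def connecting {S : ShortComplex (Sheaf J AddCommGrpCat.{u})} (hS : S.ShortExact) (n : ℕ) :
    Sheaf.H S.X₃ n →+ Sheaf.H S.X₁ (n + 1) :=
  hS.extClass.postcomp _ rfl

end Cohomology

section EquivariantCohomology

variable {E : Type*} [NormedAddCommGroup E] [NormedSpace ℝ E]
  {H : Type*} [TopologicalSpace H] {I : ModelWithCorners ℝ E H}
  {M : Type u} [TopologicalSpace M] [ChartedSpace H M] {τ : SmoothInvolution I M}

/-- Grothendieck's equivariant sheaf cohomology `Hⁿ(M; ℤ/2, F)`: the right derived functors of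
the functor of invariant global sections `F ↦ Γ(M, F)^{ℤ/2} = Hom(ℤ, F)`. -/
abbrev EqCohomology (F : Z2Sheaf τ) (n : ℕ) : Type u := Sheaf.H F n

/-- The action of the nontrivial element of `ℤ/2` on global sections, as an automorphism of the
object `M` of the equivariant site. -/
def EqOpens.flipTop (τ : SmoothInvolution I M) :
    (EqOpens.incl τ).obj ⊤ ⟶ (EqOpens.incl τ).obj ⊤ :=
  EqOpens.Hom.mk 1 fun _ _ => trivial

/-- The group `Γ(M, F)^{ℤ/2}` of invariant global sections of a `ℤ/2`-sheaf. -/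
def invariantSections (F : Z2Sheaf τ) : AddSubgroup (F.obj.obj (op ((EqOpens.incl τ).obj ⊤))) :=
  ((F.obj.map (EqOpens.flipTop τ).op).hom - AddMonoidHom.id _).ker

/-- The global section defined by a morphism from the constant sheaf `ℤ`. -/
def sectionOfHom (F : Z2Sheaf τ)
    (t : (constantSheaf (EqOpens.topology τ) AddCommGrpCat.{u}).obj
      (AddCommGrpCat.of (ULift ℤ)) ⟶ F) : F.obj.obj (op ((EqOpens.incl τ).obj ⊤)) :=
  ((toSheafify (EqOpens.topology τ) ((Functor.const _).obj (AddCommGrpCat.of (ULift.{u} ℤ))) ≫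
    t.hom).app (op ((EqOpens.incl τ).obj ⊤))).hom ⟨1⟩

/-- Morphisms from the constant sheaf `ℤ` to `F` are the invariant global sections of `F`, so that
`Ext`-groups out of the constant sheaf are the derived functors of `F ↦ Γ(M, F)^{ℤ/2}`. -/
lemma sectionOfHom_bijOn (F : Z2Sheaf τ) :
    Set.BijOn (sectionOfHom F) Set.univ (invariantSections F) := by
  let P : (EqOpens τ)ᵒᵖ ⥤ AddCommGrpCat.{u} :=
    (Functor.const _).obj (AddCommGrpCat.of (ULift.{u} ℤ))
  let top (U : EqOpens τ) : U ⟶ (EqOpens.incl τ).obj ⊤ := EqOpens.Hom.mk 0 fun _ _ => trivial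
  refine ⟨fun t _ => ?_, fun t _ t' _ h => ?_, fun s hs => ?_⟩
  · let T : P ⟶ F.obj := toSheafify (EqOpens.topology τ) P ≫ t.hom
    exact sub_eq_zero.2
      (ConcreteCategory.congr_hom (T.naturality (EqOpens.flipTop τ).op) ⟨1⟩).symm
  · refine Sheaf.hom_ext (sheafify_hom_ext _ _ _ F.property ?_)
    let T : P ⟶ F.obj := toSheafify (EqOpens.topology τ) P ≫ t.hom
    let T' : P ⟶ F.obj := toSheafify (EqOpens.topology τ) P ≫ t'.hom
    have h1 : ∀ U : (EqOpens τ)ᵒᵖ, (T.app U).hom ⟨1⟩ = (T'.app U).hom ⟨1⟩ := fun U =>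
      (ConcreteCategory.congr_hom (T.naturality (top U.unop).op) ⟨1⟩).trans
        ((congrArg (F.obj.map (top U.unop).op).hom h).trans
          (ConcreteCategory.congr_hom (T'.naturality (top U.unop).op) ⟨1⟩).symm)
    change T = T'
    ext U n
    have hn : n = n.down • (⟨1⟩ : ULift.{u} ℤ) := by
      refine ULift.ext _ _ ?_
      change n.down = n.down • (1 : ℤ)
      simp
    change (T.app U).hom n = (T'.app U).hom n
    rw [hn, map_zsmul, map_zsmul, h1]
  · have hinv : F.obj.map (EqOpens.flipTop τ).op s = s := sub_eq_zero.1 hs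
    have hkey : ∀ {V U : EqOpens τ} (k : V ⟶ U),
        F.obj.map k.op (F.obj.map (top U).op s) = F.obj.map (top V).op s := by
      intro V U k
      have h2 : ∀ l : ZMod 2, l = 0 ∨ l = 1 := by decide
      obtain hl | hl := h2 (EqOpens.Hom.label k)
      · have e : k ≫ top U = top V := EqOpens.hom_ext (by
          change 0 + EqOpens.Hom.label k = 0
          rw [hl, add_zero])
        rw [← ConcreteCategory.comp_apply, ← F.obj.map_comp, ← op_comp, e]
      · have e : k ≫ top U = top V ≫ EqOpens.flipTop τ := EqOpens.hom_ext (by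
          change 0 + EqOpens.Hom.label k = 1 + 0
          rw [hl, add_zero, zero_add])
        rw [← ConcreteCategory.comp_apply, ← F.obj.map_comp, ← op_comp, e, op_comp,
          F.obj.map_comp, ConcreteCategory.comp_apply, hinv]
    let T : P ⟶ F.obj :=
      { app := fun U => AddCommGrpCat.ofHom (AddMonoidHom.mk'
          (fun n : ULift.{u} ℤ => n.down • F.obj.map (top U.unop).op s)
          fun m n => add_zsmul _ _ _)
        naturality := fun U V k => by
          ext n
          change n.down • F.obj.map (top V.unop).op s =
            (F.obj.map k).hom (n.down • F.obj.map (top U.unop).op s)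
          rw [map_zsmul]
          exact congrArg (n.down • ·) (hkey k.unop).symm }
    refine ⟨⟨sheafifyLift _ T F.property⟩, trivial, ?_⟩
    have h3 : toSheafify (EqOpens.topology τ) P ≫ sheafifyLift _ T F.property = T :=
      toSheafify_sheafifyLift _ _ _
    refine (congrArg (fun q : P ⟶ F.obj =>
      (q.app (op ((EqOpens.incl τ).obj ⊤))).hom ⟨1⟩) h3).trans ?_
    have e : (top ((EqOpens.incl τ).obj ⊤)) = 𝟙 _ := EqOpens.hom_ext rfl
    change (1 : ℤ) • F.obj.map (top ((EqOpens.incl τ).obj ⊤)).op s = s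
    rw [one_zsmul, e, op_id, F.obj.map_id]
    rfl

/-- The sheaf cohomology `Hⁿ(M, F)` of the underlying sheaf of a `ℤ/2`-sheaf. -/
abbrev Cohomology (F : Z2Sheaf τ) (n : ℕ) : Type u := Sheaf.H ((forgetAction τ).obj F) n

/-- The map `Hⁿ(M; ℤ/2, F) → Hⁿ(M, F)` forgetting equivariance. -/
def forgetEquivariance (F : Z2Sheaf τ) (n : ℕ) : EqCohomology F n →+ Cohomology F n :=
  cohomologyRestrict (EqOpens.incl τ) F n

variable (τ) in
/-- The preimage functor `U ↦ τ⁻¹ U` on open subsets. -/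
def preimageFunctor : Opens M ⥤ Opens M where
  obj U := ⟨τ.toFun ⁻¹' U, U.isOpen.preimage τ.contMDiff.continuous⟩
  map f := homOfLE fun _ hx => f.le hx

variable (τ) in
/-- As `τ` is an involution, `U ↦ τ⁻¹ U` is adjoint to itself. -/
def preimageAdj : preimageFunctor τ ⊣ preimageFunctor τ :=
  Adjunction.mkOfUnitCounit
    { unit :=
        { app := fun U => homOfLE fun x hx => by
            change τ.toFun (τ.toFun x) ∈ U
            rwa [τ.involutive x] }
      counit :=
        { app := fun U => homOfLE fun x hx => by
            change τ.toFun (τ.toFun x) ∈ U at hx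
            rwa [τ.involutive x] at hx } }

instance : (preimageFunctor τ).IsCocontinuous (Opens.grothendieckTopology M)
    (Opens.grothendieckTopology M) where
  cover_lift {U S} hS x hx := by
    have hx' : τ.toFun (τ.toFun x) ∈ U := by rwa [τ.involutive x]
    obtain ⟨V, f, hf, hxV⟩ := hS (τ.toFun x) hx'
    refine ⟨(preimageFunctor τ).obj V, homOfLE fun y hy => ?_, ?_, hxV⟩
    · have : τ.toFun (τ.toFun y) ∈ U := f.le hy
      rwa [τ.involutive y] at this
    · refine S.downward_closed hf (homOfLE fun y hy => ?_)
      change τ.toFun (τ.toFun y) ∈ V at hy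
      rwa [τ.involutive y] at hy

instance : (preimageFunctor τ).IsContinuous (Opens.grothendieckTopology M)
    (Opens.grothendieckTopology M) :=
  (preimageAdj τ).isContinuous_of_isCocontinuous _ _

variable (τ) in
/-- The direct image functor `τ_*` on sheaves on `M`: `(τ_* F)(U) = F(τ⁻¹ U)`. -/
abbrev directImage : AbSheaf M ⥤ AbSheaf M :=
  (preimageFunctor τ).sheafPushforwardContinuous AddCommGrpCat.{u}
    (Opens.grothendieckTopology M) (Opens.grothendieckTopology M)

instance : (directImage τ).IsRightAdjoint :=
  ((preimageAdj τ).sheafPushforwardContinuous (E := AddCommGrpCat.{u}) (Opens.grothendieckTopology M)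
    (Opens.grothendieckTopology M)).isRightAdjoint

instance : (directImage τ).IsLeftAdjoint :=
  ((preimageAdj τ).sheafPushforwardContinuous (E := AddCommGrpCat.{u}) (Opens.grothendieckTopology M)
    (Opens.grothendieckTopology M)).isLeftAdjoint

/-- The morphism `U ⟶ τ⁻¹ U` labelled by the nontrivial element of `ℤ/2`. -/
def EqOpens.flip (U : Opens M) :
    (EqOpens.incl τ).obj U ⟶ (EqOpens.incl τ).obj ((preimageFunctor τ).obj U) :=
  EqOpens.Hom.mk 1 fun x hx => by
    change τ.toFun (τ.toFun x) ∈ U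
    rwa [τ.involutive x]

/-- The action `F(τ⁻¹ U) → F(U)` of the nontrivial element of `ℤ/2`, as a morphism of
sheaves `τ_* F ⟶ F` on `M`. -/
def actionHom (F : Z2Sheaf τ) :
    (directImage τ).obj ((forgetAction τ).obj F) ⟶ (forgetAction τ).obj F :=
  ObjectProperty.homMk
    { app := fun U => F.obj.map (EqOpens.flip U.unop).op
      naturality := fun U V f => by
        refine (F.obj.map_comp _ _).symm.trans (Eq.trans ?_ (F.obj.map_comp _ _))
        refine congrArg F.obj.map (Quiver.Hom.unop_inj (EqOpens.hom_ext ?_))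
        change (0 : ZMod 2) + 1 = 1 + 0
        simp }

/-- The involution `τ*` of `Hⁿ(M, F)`, for a `ℤ/2`-sheaf `F`: a global section `s` is pulled back
to the section `s` of `τ_* F`, to which the action of `τ` is applied. -/
def tauStar (F : Z2Sheaf τ) (n : ℕ) : Cohomology F n →+ Cohomology F n :=
  (Sheaf.H.map (actionHom F) n).comp
    (cohomologyRestrict (preimageFunctor τ) ((forgetAction τ).obj F) n)

end EquivariantCohomology

/-! ### Sheaves of functions -/

section Functions

variable {E : Type*} [NormedAddCommGroup E] [NormedSpace ℝ E]
  {H : Type*} [TopologicalSpace H] {I : ModelWithCorners ℝ E H}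
  {M : Type u} [TopologicalSpace M] [ChartedSpace H M] {τ : SmoothInvolution I M}

/-- A class of functions on open subsets of `M` with values in an abelian group `A`: a subgroup of
the functions on each open subset, described by a local condition and stable under restriction
and under composition with `τ`. -/
structure FunctionClass (τ : SmoothInvolution I M) (A : Type) [AddCommGroup A] where
  sections : ∀ U : Opens M, AddSubgroup (U → A)
  comp_act : ∀ {U V : Opens M} (g : ZMod 2) (h : ∀ x ∈ U, τ.act g x ∈ V) {f : V → A},
    f ∈ sections V → (fun x : U => f ⟨τ.act g x, h x x.2⟩) ∈ sections U
  of_local : ∀ {U : Opens M} {f : U → A}, (∀ x ∈ U, ∃ (V : Opens M) (h : V ≤ U), x ∈ V ∧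
    (fun y : V => f ⟨y, h y.2⟩) ∈ sections V) → f ∈ sections U

/-- The action of `ℤ/2` on `A` given by an involution `σ`. -/
def coeffAct {A : Type} [AddCommGroup A] (σ : A →+ A) (g : ZMod 2) : A →+ A :=
  if g = 0 then AddMonoidHom.id A else σ

lemma coeffAct_add {A : Type} [AddCommGroup A] {σ : A →+ A} (hσ : Function.Involutive σ)
    (g h : ZMod 2) (a : A) : coeffAct σ (g + h) a = coeffAct σ h (coeffAct σ g a) := by
  have ha := hσ a
  have h2 : ∀ k : ZMod 2, k = 0 ∨ k = 1 := by decide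
  have h11 : (1 : ZMod 2) + 1 = 0 := by decide
  obtain rfl | rfl := h2 g <;> obtain rfl | rfl := h2 h <;> simp [coeffAct, h11, ha]

/-- Coefficients for a `ℤ/2`-sheaf of functions: a class of `A`-valued functions and an involution
`σ` of `A` preserving it.  The involution of the sheaf is `f ↦ σ ∘ f ∘ τ`. -/
structure Coefficients (τ : SmoothInvolution I M) (A : Type) [AddCommGroup A] where
  cls : FunctionClass τ A
  σ : A →+ A
  involutive : Function.Involutive σ
  comp_mem : ∀ {U : Opens M} {f : U → A}, f ∈ cls.sections U → (fun x => σ (f x)) ∈ cls.sections U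

namespace Coefficients

variable {A : Type} [AddCommGroup A] (S : Coefficients τ A)

lemma coeffAct_mem {U : Opens M} {f : U → A} (hf : f ∈ S.cls.sections U) (g : ZMod 2) :
    (fun x => coeffAct S.σ g (f x)) ∈ S.cls.sections U := by
  unfold coeffAct
  split_ifs
  · exact hf
  · exact S.comp_mem hf

/-- The presheaf of functions: a morphism `U ⟶ V` labelled by `g` sends `f : V → A` to
`σᵍ ∘ f ∘ τᵍ : U → A`. -/
def presheaf : (EqOpens τ)ᵒᵖ ⥤ AddCommGrpCat.{u} where
  obj U := AddCommGrpCat.of (S.cls.sections U.unop.toOpens)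
  map {V U} k := AddCommGrpCat.ofHom
    { toFun := fun f => ⟨fun x => coeffAct S.σ k.unop.label
          (f.1 ⟨τ.act k.unop.label x, k.unop.mapsTo x x.2⟩),
        S.coeffAct_mem (S.cls.comp_act k.unop.label k.unop.mapsTo f.2) _⟩
      map_zero' := by ext x; simp
      map_add' := fun f f' => by ext x; simp }
  map_id V := by
    ext f x
    rfl
  map_comp {V U W} k l := by
    ext f x
    refine (coeffAct_add S.involutive _ _ _).trans ?_
    change coeffAct S.σ _ (coeffAct S.σ _ (f.1 _)) = coeffAct S.σ _ (coeffAct S.σ _ (f.1 _))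
    congr 3
    exact congrArg f.1 (Subtype.ext (τ.act_add _ _ _))

lemma isSheaf_presheaf : Presheaf.IsSheaf (EqOpens.topology τ) S.presheaf := by
  rw [Presheaf.isSheaf_iff_isSheaf_forget _ _ (forget AddCommGrpCat.{u}),
    isSheaf_iff_isSheaf_of_type]
  intro U R hR s hs
  choose V hV hxV hRV using hR
  let s' : ∀ {Y : EqOpens τ} (k : Y ⟶ U) (_ : R k), S.cls.sections Y.toOpens := fun k hk => s k hk
  let g : U.toOpens → A := fun x => (s' _ (hRV x.1 x.2)).1 ⟨x.1, hxV x.1 x.2⟩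
  have key : ∀ {Y : EqOpens τ} (k : Y ⟶ U) (hk : R k) (y : Y.toOpens),
      coeffAct S.σ (EqOpens.Hom.label k)
        (g ⟨τ.act (EqOpens.Hom.label k) y, EqOpens.Hom.mapsTo k y y.2⟩) = (s' k hk).1 y := by
    intro Y k hk y
    have hz := EqOpens.Hom.mapsTo k y y.2
    let W : EqOpens τ := ⟨Y.toOpens ⊓ ⟨τ.act (EqOpens.Hom.label k) ⁻¹' (V _ hz),
      (V _ hz).isOpen.preimage (τ.contMDiff_act _).continuous⟩⟩
    let a : W ⟶ Y := EqOpens.Hom.mk 0 fun x hx => hx.1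
    let b : W ⟶ (EqOpens.incl τ).obj (V _ hz) :=
      EqOpens.Hom.mk (EqOpens.Hom.label k) fun x hx => hx.2
    have h := hs a b hk (hRV _ hz) (EqOpens.hom_ext (by
      change EqOpens.Hom.label k + 0 = 0 + EqOpens.Hom.label k
      simp))
    have hy := congrArg (fun t : S.cls.sections W.toOpens => t.1 ⟨y, ⟨y.2, hxV _ hz⟩⟩) h
    exact hy.symm
  have key0 : ∀ {Y : Opens M} (h : Y ≤ U.toOpens) (hk : R ((EqOpens.incl τ).map (homOfLE h)))
      (y : Y), g ⟨y, h y.2⟩ = (s' _ hk).1 y := fun h hk y => key _ hk y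
  have hg : g ∈ S.cls.sections U.toOpens := by
    refine S.cls.of_local fun x hx => ⟨V x hx, hV x hx, hxV x hx, ?_⟩
    have e : (fun y : V x hx => g ⟨y, hV x hx y.2⟩) = (s' _ (hRV x hx)).1 :=
      funext fun y => key0 _ (hRV x hx) y
    rw [e]
    exact (s' _ (hRV x hx)).2
  refine ⟨(⟨g, hg⟩ : S.cls.sections U.toOpens), ?_, ?_⟩
  · intro Y k hk
    exact Subtype.ext (funext fun y => key k hk y)
  · intro t ht
    refine Subtype.ext (funext fun x => ?_)
    exact congrArg (fun r : S.cls.sections (V x.1 x.2) => r.1 ⟨x.1, hxV x.1 x.2⟩)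
      (ht _ (hRV x.1 x.2))

/-- The `ℤ/2`-sheaf of functions attached to the coefficients. -/
def sheaf : Z2Sheaf τ := ⟨S.presheaf, S.isSheaf_presheaf⟩

/-- A homomorphism of coefficient groups that respects the classes of functions. -/
structure Hom {B : Type} [AddCommGroup B] (T : Coefficients τ B) where
  toHom : A →+ B
  comp_mem : ∀ {U : Opens M} {f : U → A}, f ∈ S.cls.sections U →
    (fun x => toHom (f x)) ∈ T.cls.sections U

variable {S} {B : Type} [AddCommGroup B] {T : Coefficients τ B}

/-- The map on sections `f ↦ φ ∘ f`. -/
def Hom.mapSections (φ : S.Hom T) (U : Opens M) : S.cls.sections U →+ T.cls.sections U where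
  toFun f := ⟨fun x => φ.toHom (f.1 x), φ.comp_mem f.2⟩
  map_zero' := by ext x; simp
  map_add' f g := by ext x; simp

/-- The morphism `f ↦ φ ∘ f` of underlying sheaves on `M` (`φ` need not be equivariant). -/
def Hom.toSheafHom (φ : S.Hom T) :
    (forgetAction τ).obj S.sheaf ⟶ (forgetAction τ).obj T.sheaf :=
  ObjectProperty.homMk
    { app := fun U => AddCommGrpCat.ofHom (φ.mapSections U.unop)
      naturality := fun U V k => by
        ext f
        rfl }

/-- The morphism `f ↦ φ ∘ f` of `ℤ/2`-sheaves, if `φ` is equivariant. -/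
def Hom.toZ2SheafHom (φ : S.Hom T) (hφ : ∀ a, φ.toHom (S.σ a) = T.σ (φ.toHom a)) :
    S.sheaf ⟶ T.sheaf :=
  ObjectProperty.homMk
    { app := fun U => AddCommGrpCat.ofHom (φ.mapSections U.unop.toOpens)
      naturality := fun U V k => by
        have h : ∀ (g : ZMod 2) (a : A),
            φ.toHom (coeffAct S.σ g a) = coeffAct T.σ g (φ.toHom a) := by
          intro g a
          unfold coeffAct
          split_ifs
          · rfl
          · exact hφ a
        ext f
        exact Subtype.ext (funext fun x => h _ _) }

end Coefficients

lemma contMDiff_actRestrict {U V : Opens M} (g : ZMod 2) (h : ∀ x ∈ U, τ.act g x ∈ V) :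
    ContMDiff I I ∞ (fun x : U => (⟨τ.act g x, h x x.2⟩ : V)) := by
  rw [← ContMDiff.subtypeVal_comp_iff]
  exact (τ.contMDiff_act g).comp contMDiff_subtype_val

lemma contMDiff_of_local {E' : Type*} [NormedAddCommGroup E'] [NormedSpace ℝ E']
    {H' : Type*} [TopologicalSpace H'] {I' : ModelWithCorners ℝ E' H'}
    {N : Type*} [TopologicalSpace N] [ChartedSpace H' N] {U : Opens M} {f : U → N}
    (h : ∀ x ∈ U, ∃ (V : Opens M) (h : V ≤ U), x ∈ V ∧
      ContMDiff I I' ∞ (fun y : V => f ⟨y, h y.2⟩)) : ContMDiff I I' ∞ f := by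
  intro x
  obtain ⟨V, hV, hxV, hf⟩ := h x x.2
  let V' : Opens U := ⟨Subtype.val ⁻¹' V, V.isOpen.preimage continuous_subtype_val⟩
  have hi : ContMDiff I I ∞ (fun y : V' => (⟨y.1.1, y.2⟩ : V)) := by
    rw [← ContMDiff.subtypeVal_comp_iff]
    exact (contMDiff_subtype_val (U := U)).comp (contMDiff_subtype_val (U := V'))
  have hc : ContMDiff I I' ∞ (fun y : V' => f y) := hf.comp hi
  exact contMDiffAt_subtype_iff.1 (hc ⟨x, hxV⟩)

variable (τ) in
/-- Smooth functions with values in `U(1)` (written additively). -/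
def circleFunctions : FunctionClass τ (Additive Circle) where
  sections U :=
    { carrier := {f | ContMDiff I (𝓡 1) ∞ (fun x : U => (f x).toMul)}
      add_mem' := fun hf hg => hf.mul hg
      zero_mem' := contMDiff_const
      neg_mem' := fun hf => hf.inv }
  comp_act {U V} g h f hf := by
    exact ContMDiff.comp (I' := I) (g := fun x : V => (f x).toMul) hf (contMDiff_actRestrict g h)
  of_local h := contMDiff_of_local h

variable (τ) in
/-- Smooth real functions. -/
def realFunctions : FunctionClass τ ℝ where
  sections U :=
    { carrier := {f | ContMDiff I 𝓘(ℝ, ℝ) ∞ f}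
      add_mem' := fun hf hg => hf.add hg
      zero_mem' := contMDiff_const
      neg_mem' := fun hf => hf.neg }
  comp_act {U V} g h f hf := by
    exact ContMDiff.comp (I' := I) (g := f) hf (contMDiff_actRestrict g h)
  of_local h := contMDiff_of_local h

variable (τ) in
/-- Locally constant functions with values in `ℤ`. -/
def intFunctions : FunctionClass τ ℤ where
  sections U :=
    { carrier := {f | IsLocallyConstant f}
      add_mem' := fun hf hg => hf.add hg
      zero_mem' := IsLocallyConstant.const 0
      neg_mem' := fun hf => hf.neg }
  comp_act {U V} g h f hf := by
    refine hf.comp_continuous (f := fun x : U => (⟨τ.act g x, h x x.2⟩ : V)) ?_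
    exact ((τ.contMDiff_act g).continuous.comp continuous_subtype_val).subtype_mk _
  of_local {U f} h := by
    refine (IsLocallyConstant.iff_continuous f).2 (continuous_iff_continuousAt.2 fun x => ?_)
    obtain ⟨V, hV, hxV, hf⟩ := h x x.2
    have ho : Topology.IsOpenEmbedding (Opens.inclusion hV) := Opens.isOpenEmbedding_of_le hV
    exact (ho.continuousAt_iff (x := ⟨x, hxV⟩)).1 hf.continuous.continuousAt

/-- Pairs of functions from a given class. -/
def FunctionClass.prod {A : Type} [AddCommGroup A] (F : FunctionClass τ A) :
    FunctionClass τ (A × A) where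
  sections U :=
    { carrier := {f | (fun x => (f x).1) ∈ F.sections U ∧ (fun x => (f x).2) ∈ F.sections U}
      add_mem' := fun hf hg => ⟨add_mem hf.1 hg.1, add_mem hf.2 hg.2⟩
      zero_mem' := ⟨zero_mem _, zero_mem _⟩
      neg_mem' := fun hf => ⟨neg_mem hf.1, neg_mem hf.2⟩ }
  comp_act g h _ hf := ⟨F.comp_act g h hf.1, F.comp_act g h hf.2⟩
  of_local h := ⟨F.of_local fun x hx => by
      obtain ⟨V, hV, hxV, hf⟩ := h x hx
      exact ⟨V, hV, hxV, hf.1⟩,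
    F.of_local fun x hx => by
      obtain ⟨V, hV, hxV, hf⟩ := h x hx
      exact ⟨V, hV, hxV, hf.2⟩⟩

/-- The trivial action on the coefficients: the involution is `f ↦ f ∘ τ`. -/
def FunctionClass.trivial {A : Type} [AddCommGroup A] (F : FunctionClass τ A) :
    Coefficients τ A where
  cls := F
  σ := AddMonoidHom.id A
  involutive _ := rfl
  comp_mem hf := hf

/-- The inversion action on the coefficients: the involution is `f ↦ -(f ∘ τ)`. -/
def FunctionClass.inverted {A : Type} [AddCommGroup A] (F : FunctionClass τ A) :
    Coefficients τ A where
  cls := F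
  σ := negAddMonoidHom
  involutive a := neg_neg a
  comp_mem hf := neg_mem hf

/-- The swap action on pairs: the involution is `(f, h) ↦ (h ∘ τ, f ∘ τ)`. -/
def FunctionClass.induced {A : Type} [AddCommGroup A] (F : FunctionClass τ A) :
    Coefficients τ (A × A) where
  cls := F.prod
  σ := (AddMonoidHom.snd A A).prod (AddMonoidHom.fst A A)
  involutive _ := rfl
  comp_mem hf := ⟨hf.2, hf.1⟩

variable (τ) in
/-- The `ℤ/2`-sheaf `𝒰(1)`: smooth `U(1)`-valued functions, with `τ` acting by `f ↦ f ∘ τ`. -/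
def unitary : Z2Sheaf τ := (circleFunctions τ).trivial.sheaf

variable (τ) in
/-- The `ℤ/2`-sheaf of smooth `U(1)`-valued functions with the conjugation action
`τ(f) = conj(f) ∘ τ` (conjugation is inversion on `U(1)`, which is written additively here). -/
def unitaryBar : Z2Sheaf τ := (circleFunctions τ).inverted.sheaf

variable (τ) in
/-- The `ℤ/2`-sheaf `𝒰(1) ⊕ τ⁻¹𝒰(1)` with the action interchanging the summands.  A section
`(f, h)` over `U`, where `h` is a function on `τ U`, is recorded as the pair of functions
`(f, h ∘ τ)` on `U`. -/
def unitaryInduced : Z2Sheaf τ := (circleFunctions τ).induced.sheaf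

variable (τ) in
/-- The `ℤ/2`-sheaf of smooth real functions with `τ` acting by `f ↦ f ∘ τ`. -/
def reals : Z2Sheaf τ := (realFunctions τ).trivial.sheaf

variable (τ) in
/-- The `ℤ/2`-sheaf of locally constant integer functions with `τ` acting by `f ↦ f ∘ τ`. -/
def integers : Z2Sheaf τ := (intFunctions τ).trivial.sheaf

variable (τ) in
/-- The inclusion of the integer functions into the real functions. -/
def intToReal : integers τ ⟶ reals τ :=
  Coefficients.Hom.toZ2SheafHom (S := (intFunctions τ).trivial) (T := (realFunctions τ).trivial)
    { toHom := Int.castAddHom ℝ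
      comp_mem := fun {U f} hf x => by
        have h := (hf.eventually_eq x).mono fun y (hy : f y = f x) =>
          congrArg (Int.castAddHom ℝ) hy
        exact contMDiffAt_const.congr_of_eventuallyEq h }
    fun _ => rfl

variable (τ) in
/-- The exponential `f ↦ exp(2πi f)`. -/
def realToUnitary : reals τ ⟶ unitary τ :=
  Coefficients.Hom.toZ2SheafHom (S := (realFunctions τ).trivial)
    (T := (circleFunctions τ).trivial)
    { toHom :=
        { toFun := fun t => Additive.ofMul (Circle.exp (2 * Real.pi * t))
          map_zero' := by simp
          map_add' := fun s t => by rw [mul_add, Circle.exp_add]; rfl }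
      comp_mem := fun {U f} hf =>
        contMDiff_circleExp.comp ((contDiff_const.mul contDiff_id).contMDiff.comp hf) }
    fun _ => rfl

variable (τ) in
/-- The exponential sequence `0 → ℤ → ℝ → U(1) → 0` of `ℤ/2`-sheaves. -/
def exponentialSequence : ShortComplex (Z2Sheaf τ) where
  f := intToReal τ
  g := realToUnitary τ
  zero := by
    ext U f
    refine Subtype.ext (funext fun x => ?_)
    exact congrArg Additive.ofMul (Circle.exp_eq_one.2 ⟨f.1 x, mul_comm _ _⟩)

lemma mono_intToReal : Mono (intToReal τ) := by
  have : ∀ U, Mono ((intToReal τ).hom.app U) := fun U => by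
    rw [AddCommGrpCat.mono_iff_injective]
    intro f g h
    refine Subtype.ext (funext fun x => Int.cast_injective (α := ℝ) ?_)
    exact congrFun (congrArg Subtype.val h) x
  have : Mono (intToReal τ).hom := NatTrans.mono_of_mono_app _
  exact Sheaf.Hom.mono_of_presheaf_mono _ _ _

lemma exists_log {U : Opens M} {f : U → Circle} (hf : ContMDiff I (𝓡 1) ∞ f) (x : U) :
    ∃ (V : Opens M) (h : V ≤ U) (t : V → ℝ), x.1 ∈ V ∧ ContMDiff I 𝓘(ℝ, ℝ) ∞ t ∧
      ∀ y : V, Circle.exp (2 * Real.pi * t y) = f ⟨y, h y.2⟩ := by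
  have : Fact (Module.finrank ℝ ℂ = 1 + 1) := Complex.finrank_real_complex_fact
  have hc : ContMDiff I 𝓘(ℝ, ℂ) ∞ (fun y : U => ((f y * (f x)⁻¹ : Circle) : ℂ)) :=
    (contMDiff_coe_sphere (E := ℂ) (n := 1)).comp (hf.mul contMDiff_const)
  let W : Set U := {y | ((f y * (f x)⁻¹ : Circle) : ℂ) ∈ Complex.slitPlane}
  have hW : IsOpen W := Complex.isOpen_slitPlane.preimage hc.continuous
  let V : Opens M := ⟨Subtype.val '' W, U.isOpen.isOpenMap_subtype_val _ hW⟩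
  have hVU : V ≤ U := by
    rintro _ ⟨y, -, rfl⟩
    exact y.2
  have hVW : ∀ y : V, ((f ⟨y, hVU y.2⟩ * (f x)⁻¹ : Circle) : ℂ) ∈ Complex.slitPlane := by
    rintro ⟨_, ⟨y, hy, rfl⟩⟩
    exact hy
  have hi : ContMDiff I I ∞ (fun y : V => (⟨y.1, hVU y.2⟩ : U)) := by
    rw [← ContMDiff.subtypeVal_comp_iff]
    exact contMDiff_subtype_val
  refine ⟨V, hVU, fun y => (Complex.arg (f ⟨y, hVU y.2⟩ * (f x)⁻¹ : Circle) +
    Complex.arg (f x)) * (2 * Real.pi)⁻¹, ⟨x, ?_, rfl⟩, ?_, fun y => ?_⟩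
  · change ((f x * (f x)⁻¹ : Circle) : ℂ) ∈ Complex.slitPlane
    rw [mul_inv_cancel, Circle.coe_one]
    exact Complex.one_mem_slitPlane
  · have harg : ∀ z ∈ Complex.slitPlane, ContDiffAt ℝ ∞ Complex.arg z := fun z hz => by
      have h1 : ContDiffAt ℝ ∞ Complex.log z := (Complex.contDiffAt_log hz).restrict_scalars ℝ
      have h2 := Complex.imCLM.contDiff.contDiffAt.comp z h1
      refine h2.congr_of_eventuallyEq (Filter.Eventually.of_forall fun w => ?_)
      simp [Complex.log_im]
    intro y
    have h3 := ContMDiffAt.comp y (harg _ (hVW y)).contMDiffAt ((hc.comp hi) y)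
    exact (h3.add contMDiffAt_const).mul contMDiffAt_const
  · have hp : 2 * Real.pi ≠ 0 := by positivity
    rw [mul_comm, inv_mul_cancel_right₀ hp, Circle.exp_add, Circle.exp_arg, Circle.exp_arg,
      inv_mul_cancel_right]

lemma epi_realToUnitary : Epi (realToUnitary τ) := by
  rw [← Sheaf.isLocallySurjective_iff_epi']
  constructor
  intro U f y hy
  obtain ⟨V, hV, t, hyV, ht, h⟩ := exists_log (f := fun x => (f.1 x).toMul) f.2 ⟨y, hy⟩
  refine ⟨V, hV, hyV, (⟨t, ht⟩ : (realFunctions τ).sections V), ?_⟩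
  exact Subtype.ext (funext fun x => congrArg Additive.ofMul (h x))

lemma exponentialSequence_shortExact : (exponentialSequence τ).ShortExact := by
  have hm : Mono (exponentialSequence τ).f := mono_intToReal
  have he : Epi (exponentialSequence τ).g := epi_realToUnitary
  refine { exact := ShortComplex.exact_of_f_is_kernel _ ?_, mono_f := hm, epi_g := he }
  refine Limits.KernelFork.IsLimit.ofι' _ _ fun {T} k hk => ?_
  have hex : ∀ (U : (EqOpens τ)ᵒᵖ) (t : T.obj.obj U) (x : U.unop.toOpens),
      ∃ n : ℤ, (n : ℝ) = ((k.hom.app U t : (realFunctions τ).sections U.unop.toOpens)).1 x := by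
    intro U t x
    have h1 := congrArg (fun q : T ⟶ unitary τ =>
      ((q.hom.app U t : (circleFunctions τ).sections U.unop.toOpens)).1 x) hk
    obtain ⟨n, hn⟩ := Circle.exp_eq_one.1 (congrArg Additive.toMul h1)
    refine ⟨n, ?_⟩
    rw [mul_comm] at hn
    exact (mul_right_cancel₀ (by positivity) hn).symm
  choose n hn using hex
  have hloc : ∀ (U : (EqOpens τ)ᵒᵖ) (t : T.obj.obj U),
      n U t ∈ (intFunctions τ).sections U.unop.toOpens := by
    intro U t
    refine (IsLocallyConstant.iff_continuous _).2
      (Int.isClosedEmbedding_coe_real.isInducing.continuous_iff.2 ?_)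
    have h2 := ((k.hom.app U t : (realFunctions τ).sections U.unop.toOpens)).2.continuous
    exact h2.congr fun x => (hn U t x).symm
  let l : T ⟶ integers τ := ObjectProperty.homMk
    { app := fun U => AddCommGrpCat.ofHom (AddMonoidHom.mk'
        (fun t => (⟨n U t, hloc U t⟩ : (intFunctions τ).sections U.unop.toOpens))
        fun s t => Subtype.ext (funext fun x => Int.cast_injective (α := ℝ) (by
          change ((n U (s + t) x : ℤ) : ℝ) = ((n U s x + n U t x : ℤ) : ℝ)
          rw [Int.cast_add, hn, hn, hn, map_add]
          rfl)))
      naturality := fun U V j => by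
        ext t
        refine Subtype.ext (funext fun x => Int.cast_injective (α := ℝ) ?_)
        have h3 := congrArg
          (fun r : (realFunctions τ).sections V.unop.toOpens => r.1 x)
          (ConcreteCategory.congr_hom (k.hom.naturality j) t)
        have h4 : ∀ (g : ZMod 2) (a : ℝ), coeffAct (AddMonoidHom.id ℝ) g a = a := by
          intro g a
          unfold coeffAct
          split_ifs <;> rfl
        have h5 : ∀ (g : ZMod 2) (a : ℤ), coeffAct (AddMonoidHom.id ℤ) g a = a := by
          intro g a
          unfold coeffAct
          split_ifs <;> rfl
        change ((n V (T.obj.map j t) x : ℤ) : ℝ) =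
          ((coeffAct (AddMonoidHom.id ℤ) j.unop.label
            (n U t ⟨τ.act j.unop.label x, j.unop.mapsTo x x.2⟩) : ℤ) : ℝ)
        rw [h5, hn, hn]
        exact h3.trans (h4 _ _) }
  refine ⟨l, ?_⟩
  ext U t
  exact Subtype.ext (funext fun x => hn U t x)

/-- The connecting homomorphism `Hⁿ(M; ℤ/2, 𝒰(1)) → Hⁿ⁺¹(M; ℤ/2, ℤ)` of the exponential
sequence. -/
def eqBockstein (τ : SmoothInvolution I M) (n : ℕ) :
    EqCohomology (unitary τ) n →+ EqCohomology (integers τ) (n + 1) :=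
  connecting exponentialSequence_shortExact n

/-- The connecting homomorphism `Hⁿ(M, 𝒰(1)) → Hⁿ⁺¹(M, ℤ)` of the exponential sequence. -/
def bockstein (τ : SmoothInvolution I M) (n : ℕ) :
    Cohomology (unitary τ) n →+ Cohomology (integers τ) (n + 1) :=
  connecting (exponentialSequence_shortExact.map_of_exact (forgetAction τ)) n

/-- The homomorphism `Hⁿ(M; ℤ/2, U(1)-bar) → Hⁿ(M, 𝒰(1))` forgetting Real structures. -/
def forgetReal (τ : SmoothInvolution I M) (n : ℕ) :
    EqCohomology (unitaryBar τ) n →+ Cohomology (unitary τ) n :=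
  (Sheaf.H.map (Coefficients.Hom.toSheafHom (S := (circleFunctions τ).inverted)
    (T := (circleFunctions τ).trivial) { toHom := AddMonoidHom.id _, comp_mem := fun hf => hf })
      n).comp (forgetEquivariance (unitaryBar τ) n)

/-- The homomorphism `Hⁿ(M; ℤ/2, 𝒰(1) ⊕ τ⁻¹𝒰(1)) → Hⁿ(M, 𝒰(1))`: forget equivariance and project
to the first summand. -/
def firstSummand (τ : SmoothInvolution I M) (n : ℕ) :
    EqCohomology (unitaryInduced τ) n →+ Cohomology (unitary τ) n :=
  (Sheaf.H.map (Coefficients.Hom.toSheafHom (S := (circleFunctions τ).induced)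
    (T := (circleFunctions τ).trivial) { toHom := AddMonoidHom.fst _ _, comp_mem := fun hf => hf.1 })
      n).comp (forgetEquivariance (unitaryInduced τ) n)

variable (τ) in
/-- The morphism `𝒰(1) ⊕ τ⁻¹𝒰(1) ⟶ 𝒰(1)`, `(f, h) ↦ f (h ∘ τ)`, of `ℤ/2`-sheaves. -/
def productHom : unitaryInduced τ ⟶ unitary τ :=
  Coefficients.Hom.toZ2SheafHom (S := (circleFunctions τ).induced)
    (T := (circleFunctions τ).trivial)
    { toHom := AddMonoidHom.fst (Additive Circle) (Additive Circle) +
        AddMonoidHom.snd (Additive Circle) (Additive Circle)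
      comp_mem := fun {U _} hf =>
        ((circleFunctions τ).sections U).add_mem hf.1 hf.2 }
    fun a => add_comm a.2 a.1

/-- The homomorphism `Hⁿ(M; ℤ/2, 𝒰(1) ⊕ τ⁻¹𝒰(1)) → Hⁿ(M; ℤ/2, 𝒰(1))` induced by
`(f, h) ↦ f (h ∘ τ)`. -/
def productMap (τ : SmoothInvolution I M) (n : ℕ) :
    EqCohomology (unitaryInduced τ) n →+ EqCohomology (unitary τ) n :=
  Sheaf.H.map (productHom τ) n

/-- A class `h = [H]` in `H³(M, ℤ)` is the quantum flux of an orientifold `B`-field if it belongs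
to the kernel of `1 × τ* : H³(M, ℤ) → H³(M, ℤ)` and lifts to `H²(M; ℤ/2, U(1)-bar)`. -/
def IsOrientifoldFlux (τ : SmoothInvolution I M) (h : Cohomology (integers τ) 3) : Prop :=
  h + tauStar (integers τ) 3 h = 0 ∧
    ∃ x : EqCohomology (unitaryBar τ) 2, bockstein τ 2 (forgetReal τ 2 x) = h

end Functions

end RealGerbe

end

noncomputable section

namespace RealGerbe

section Ext

open Limits

universe w w₁ w₂ v v₁ v₂ u₀ u₁ u₂

variable {C : Type u₀} [Category.{v} C] [Abelian C] [HasExt.{w} C]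
  {D : Type u₁} [Category.{v₁} D] [Abelian D] [HasExt.{w₁} D]
  {E : Type u₂} [Category.{v₂} E] [Abelian E] [HasExt.{w₂} E]

/-- If `C` has enough injectives, a property of all `Ext`-classes may be proved by checking it on
morphisms and on composites with extension classes. -/
lemma ext_induction [EnoughInjectives C] {X : C}
    {P : ∀ (Y : C) (n : ℕ), Ext.{w} X Y n → Prop} (h₀ : ∀ (Y : C) (f : X ⟶ Y), P Y 0 (Ext.mk₀ f))
    (h₁ : ∀ (S : ShortComplex C) (hS : S.ShortExact) (n : ℕ) (x : Ext.{w} X S.X₃ n),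
      P S.X₃ n x → P S.X₁ (n + 1) (x.comp hS.extClass rfl))
    {Y : C} {n : ℕ} (x : Ext.{w} X Y n) : P Y n x := by
  induction n generalizing Y with
  | zero =>
    obtain ⟨f, rfl⟩ := (Ext.mk₀_bijective X Y).2 x
    exact h₀ Y f
  | succ n ih =>
    let S : ShortComplex C := .mk (Injective.ι Y) (cokernel.π (Injective.ι Y)) (cokernel.condition _)
    have hS : S.ShortExact :=
      { exact := ShortComplex.exact_of_g_is_cokernel _ (cokernelIsCokernel _)
        mono_f := inferInstanceAs (Mono (Injective.ι Y))
        epi_g := inferInstanceAs (Epi (cokernel.π (Injective.ι Y))) }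
    have : Injective S.X₂ := inferInstanceAs (Injective (Injective.under Y))
    obtain ⟨y, hy⟩ := Ext.covariant_sequence_exact₁ X hS x (Ext.eq_zero_of_injective _) rfl
    rw [← hy]
    exact h₁ S hS n y (ih y)

/-- A natural transformation between exact functors is compatible with the maps on `Ext`. -/
lemma mapExactFunctor_naturality [EnoughInjectives C] {F G : C ⥤ D} [F.Additive] [G.Additive]
    [PreservesFiniteLimits F] [PreservesFiniteColimits F] [PreservesFiniteLimits G]
    [PreservesFiniteColimits G] (α : F ⟶ G) {X Y : C} {n : ℕ} (x : Ext.{w} X Y n) :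
    (x.mapExactFunctor F : Ext.{w₁} _ _ n).comp (Ext.mk₀ (α.app Y)) (add_zero n) =
      (Ext.mk₀ (α.app X)).comp (x.mapExactFunctor G) (zero_add n) := by
  refine ext_induction (P := fun Y n x => (x.mapExactFunctor F : Ext.{w₁} _ _ n).comp
    (Ext.mk₀ (α.app Y)) (add_zero n) = (Ext.mk₀ (α.app X)).comp (x.mapExactFunctor G) (zero_add n))
    (fun Y f => ?_) (fun S hS n x ih => ?_) x
  · simp [Ext.mapExactFunctor_mk₀]
  · have h := ShortComplex.ShortExact.extClass_naturality (hS.map_of_exact F) (hS.map_of_exact G)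
      (S.mapNatTrans α)
    rw [← Ext.mapExactFunctor_extClass _ hS, ← Ext.mapExactFunctor_extClass _ hS] at h
    have h' : (hS.extClass.mapExactFunctor F : Ext.{w₁} _ _ 1).comp (Ext.mk₀ (α.app S.X₁))
        (add_zero 1) = (Ext.mk₀ (α.app S.X₃)).comp
          (hS.extClass.mapExactFunctor G : Ext.{w₁} _ _ 1) (zero_add 1) := h
    rw [Ext.mapExactFunctor_comp, Ext.mapExactFunctor_comp, Ext.comp_assoc_of_third_deg_zero, h',
      ← Ext.comp_assoc_of_second_deg_zero, ih, Ext.comp_assoc _ _ _ (zero_add n) rfl (by omega)]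

lemma mapExactFunctor_id [EnoughInjectives C] {X Y : C} {n : ℕ} (x : Ext.{w} X Y n) :
    (x.mapExactFunctor (𝟭 C) : Ext.{w} X Y n) = x := by
  refine ext_induction (P := fun Y n x => (x.mapExactFunctor (𝟭 C) : Ext.{w} X Y n) = x)
    (fun Y f => ?_) (fun S hS n x ih => ?_) x
  · exact Ext.mapExactFunctor_mk₀ _ _
  · rw [Ext.mapExactFunctor_comp, Ext.mapExactFunctor_extClass]
    exact congrArg (fun z => Ext.comp z _ rfl) ih

lemma mapExactFunctor_mapExactFunctor [EnoughInjectives C] (F : C ⥤ D) (G : D ⥤ E) [F.Additive]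
    [G.Additive] [PreservesFiniteLimits F] [PreservesFiniteColimits F] [PreservesFiniteLimits G]
    [PreservesFiniteColimits G] [PreservesFiniteLimits (F ⋙ G)] [PreservesFiniteColimits (F ⋙ G)]
    {X Y : C} {n : ℕ} (x : Ext.{w} X Y n) :
    ((x.mapExactFunctor F : Ext.{w₁} _ _ n).mapExactFunctor G : Ext.{w₂} _ _ n) =
      x.mapExactFunctor (F ⋙ G) := by
  refine ext_induction (P := fun Y n x =>
    ((x.mapExactFunctor F : Ext.{w₁} _ _ n).mapExactFunctor G : Ext.{w₂} _ _ n) =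
      x.mapExactFunctor (F ⋙ G))
    (fun Y f => ?_) (fun S hS n x ih => ?_) x
  · simp only [Ext.mapExactFunctor_mk₀]
    rfl
  · have h : (hS.extClass.mapExactFunctor F : Ext.{w₁} _ _ 1).mapExactFunctor G =
        (hS.extClass.mapExactFunctor (F ⋙ G) : Ext.{w₂} _ _ 1) := by
      rw [Ext.mapExactFunctor_extClass, Ext.mapExactFunctor_extClass]
      exact Ext.mapExactFunctor_extClass _ _
    rw [Ext.mapExactFunctor_comp, Ext.mapExactFunctor_comp, Ext.mapExactFunctor_comp, ih, h]

lemma comp_mapExactFunctor_unit [EnoughInjectives C] {F : C ⥤ D} {G : D ⥤ C} [F.Additive]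
    [G.Additive] [PreservesFiniteLimits F] [PreservesFiniteColimits F] [PreservesFiniteLimits G]
    [PreservesFiniteColimits G] [PreservesFiniteLimits (F ⋙ G)] [PreservesFiniteColimits (F ⋙ G)]
    (η : 𝟭 C ⟶ F ⋙ G) {X Y : C} {n : ℕ} (x : Ext.{w} X Y n) :
    x.comp (Ext.mk₀ (Y := G.obj (F.obj Y)) (η.app Y)) (add_zero n) =
      (Ext.mk₀ (Y := G.obj (F.obj X)) (η.app X)).comp
        ((x.mapExactFunctor F : Ext.{w₁} _ _ n).mapExactFunctor G : Ext.{w} _ _ n) (zero_add n) := by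
  rw [mapExactFunctor_mapExactFunctor F G]
  have h := mapExactFunctor_naturality η x
  rw [mapExactFunctor_id] at h
  exact h

lemma comp_mapExactFunctor_counit [EnoughInjectives D] {F : C ⥤ D} {G : D ⥤ C} [F.Additive]
    [G.Additive] [PreservesFiniteLimits F] [PreservesFiniteColimits F] [PreservesFiniteLimits G]
    [PreservesFiniteColimits G] [PreservesFiniteLimits (G ⋙ F)] [PreservesFiniteColimits (G ⋙ F)]
    (ε : G ⋙ F ⟶ 𝟭 D) {X Y : D} {n : ℕ} (y : Ext.{w₁} X Y n) :
    ((y.mapExactFunctor G : Ext.{w} _ _ n).mapExactFunctor F : Ext.{w₁} _ _ n).comp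
      (Ext.mk₀ (X := F.obj (G.obj Y)) (ε.app Y)) (add_zero n) =
      (Ext.mk₀ (X := F.obj (G.obj X)) (ε.app X)).comp y (zero_add n) := by
  rw [mapExactFunctor_mapExactFunctor G F]
  have h := mapExactFunctor_naturality ε y
  rw [mapExactFunctor_id] at h
  exact h

/-- For an adjunction between exact functors, `x ↦ F(x) ε` is a bijection
`Extⁿ(X, G Y) → Extⁿ(F X, Y)`. -/
lemma bijective_mapExactFunctor_comp_counit [EnoughInjectives C] [EnoughInjectives D] {F : C ⥤ D}
    {G : D ⥤ C} (adj : F ⊣ G) [F.Additive] [G.Additive] [PreservesFiniteLimits F]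
    [PreservesFiniteColimits F] [PreservesFiniteLimits G] [PreservesFiniteColimits G]
    (X : C) (Y : D) (n : ℕ) :
    Function.Bijective (fun x : Ext.{w} X (G.obj Y) n =>
      (x.mapExactFunctor F : Ext.{w₁} _ _ n).comp
        (Ext.mk₀ (X := F.obj (G.obj Y)) (Y := Y) (adj.counit.app Y)) (add_zero n)) := by
  have : PreservesFiniteLimits (F ⋙ G) := comp_preservesFiniteLimits F G
  have : PreservesFiniteColimits (F ⋙ G) := comp_preservesFiniteColimits F G
  have : PreservesFiniteLimits (G ⋙ F) := comp_preservesFiniteLimits G F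
  have : PreservesFiniteColimits (G ⋙ F) := comp_preservesFiniteColimits G F
  let inv (y : Ext.{w₁} (F.obj X) Y n) : Ext.{w} X (G.obj Y) n :=
    (Ext.mk₀ (Y := G.obj (F.obj X)) (adj.unit.app X)).comp
      (y.mapExactFunctor G : Ext.{w} _ _ n) (zero_add n)
  refine ⟨Function.LeftInverse.injective (g := inv) fun x => ?_, fun y => ⟨inv y, ?_⟩⟩
  · dsimp only [inv]
    rw [Ext.mapExactFunctor_comp, ← Ext.comp_assoc_of_third_deg_zero,
      ← comp_mapExactFunctor_unit adj.unit x, Ext.mapExactFunctor_mk₀,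
      Ext.comp_assoc_of_second_deg_zero, Ext.mk₀_comp_mk₀]
    exact (congrArg (fun z : G.obj Y ⟶ G.obj Y => x.comp (Ext.mk₀ z) (add_zero n))
      (adj.right_triangle_components Y)).trans (Ext.comp_mk₀_id x)
  · dsimp only [inv]
    rw [Ext.mapExactFunctor_comp, Ext.comp_assoc_of_third_deg_zero,
      comp_mapExactFunctor_counit adj.counit y, Ext.mapExactFunctor_mk₀,
      ← Ext.comp_assoc _ _ _ (add_zero 0) (zero_add n) (by omega), Ext.mk₀_comp_mk₀]
    exact (congrArg (fun z : F.obj X ⟶ F.obj X => (Ext.mk₀ z).comp y (zero_add n))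
      (adj.left_triangle_components X)).trans (Ext.mk₀_id_comp y)

end Ext

section Coinduction

variable {E : Type*} [NormedAddCommGroup E] [NormedSpace ℝ E]
  {H : Type*} [TopologicalSpace H] {I : ModelWithCorners ℝ E H}
  {M : Type u} [TopologicalSpace M] [ChartedSpace H M]

/-- The translate `g⁻¹ U` of an open subset `U` of `M` by `g : ℤ/2`. -/
def translate (τ : SmoothInvolution I M) (g : ZMod 2) (U : Opens M) : Opens M :=
  ⟨τ.act g ⁻¹' U, U.isOpen.preimage (τ.contMDiff_act g).continuous⟩

variable {τ : SmoothInvolution I M}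

lemma mem_translate {g : ZMod 2} {U : Opens M} {x : M} : x ∈ translate τ g U ↔ τ.act g x ∈ U :=
  Iff.rfl

lemma translate_mono {g : ZMod 2} {U V : Opens M} (h : U ≤ V) :
    translate τ g U ≤ translate τ g V := fun _ hx => h hx

/-- The tautological morphism `g⁻¹ U ⟶ U` labelled by `g`. -/
def translateHom (g : ZMod 2) (U : EqOpens τ) :
    (EqOpens.incl τ).obj (translate τ g U.toOpens) ⟶ U :=
  EqOpens.Hom.mk g fun _ hx => hx

lemma translate_le {U V : EqOpens τ} (k : U ⟶ V) (g : ZMod 2) :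
    translate τ g U.toOpens ≤ translate τ (EqOpens.Hom.label k + g) V.toOpens := fun x hx => by
  rw [mem_translate, τ.act_add]
  exact k.mapsTo _ hx

lemma translateHom_comp {U V : EqOpens τ} (k : U ⟶ V) (g : ZMod 2) :
    translateHom g U ≫ k = (EqOpens.incl τ).map (homOfLE (translate_le k g)) ≫
      translateHom (EqOpens.Hom.label k + g) V :=
  EqOpens.hom_ext (by
    change EqOpens.Hom.label k + g = (EqOpens.Hom.label k + g) + 0
    rw [add_zero])

lemma map_congr_index (F : (Opens M)ᵒᵖ ⥤ AddCommGrpCat.{u}) {U : ZMod 2 → Opens M} {W : Opens M}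
    (a : ∀ g, F.obj (op (U g))) {g g' : ZMod 2} (e : g = g') (h : W ≤ U g) (h' : W ≤ U g') :
    F.map (homOfLE h).op (a g) = F.map (homOfLE h').op (a g') := by
  subst e
  rfl

lemma map_map_apply (F : (Opens M)ᵒᵖ ⥤ AddCommGrpCat.{u}) {U V W : Opens M} (h : V ≤ U) (h' : W ≤ V)
    (a : F.obj (op U)) :
    F.map (homOfLE h').op (F.map (homOfLE h).op a) = F.map (homOfLE (h'.trans h)).op a := by
  rw [← ConcreteCategory.comp_apply, ← F.map_comp]
  rfl

lemma map_refl_apply (F : (Opens M)ᵒᵖ ⥤ AddCommGrpCat.{u}) {U : Opens M} (h : U ≤ U)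
    (a : F.obj (op U)) : F.map (homOfLE h).op a = a := by
  have : (homOfLE h).op = 𝟙 _ := rfl
  rw [this, F.map_id]
  rfl

lemma naturality_apply' {C : Type*} [Category* C] {F G : Cᵒᵖ ⥤ AddCommGrpCat.{u}} (φ : F ⟶ G)
    {U V : Cᵒᵖ} (k : U ⟶ V) (a : F.obj U) :
    φ.app V (F.map k a) = G.map k (φ.app U a) :=
  ConcreteCategory.congr_hom (φ.naturality k) a

variable (τ) in
/-- The presheaf on the equivariant site coinduced from a presheaf on `M`: its sections over `U`
are the families of sections over the translates of `U`. -/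
def coindPresheaf (F : (Opens M)ᵒᵖ ⥤ AddCommGrpCat.{u}) : (EqOpens τ)ᵒᵖ ⥤ AddCommGrpCat.{u} where
  obj U := AddCommGrpCat.of (∀ g : ZMod 2, F.obj (op (translate τ g U.unop.toOpens)))
  map {U V} k := AddCommGrpCat.ofHom (AddMonoidHom.mk'
    (fun a g => F.map (homOfLE (translate_le k.unop g)).op (a (EqOpens.Hom.label k.unop + g)))
    fun a b => funext fun g => map_add (F.map _).hom _ _)
  map_id U := by
    refine ConcreteCategory.hom_ext _ _ fun a => funext fun g => ?_
    exact (map_congr_index F a (zero_add g) _ le_rfl).trans (map_refl_apply F _ _)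
  map_comp {U V W} k l := by
    refine ConcreteCategory.hom_ext _ _ fun a => funext fun g => ?_
    refine Eq.trans ?_ (map_map_apply F _ _ _).symm
    exact map_congr_index F a (add_assoc _ _ _) _ _

lemma isSheaf_coindPresheaf (F : AbSheaf M) :
    Presheaf.IsSheaf (EqOpens.topology τ) (coindPresheaf τ F.obj) := by
  rw [Presheaf.isSheaf_iff_isSheaf_forget _ _ (forget AddCommGrpCat.{u}),
    isSheaf_iff_isSheaf_of_type]
  have hF : Presieve.IsSheaf (Opens.grothendieckTopology M) (F.obj ⋙ forget AddCommGrpCat.{u}) :=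
    (isSheaf_iff_isSheaf_of_type _ _).1
      ((Presheaf.isSheaf_iff_isSheaf_forget _ _ (forget AddCommGrpCat.{u})).1 F.property)
  intro U R hR s hs
  let s' : ∀ {Y : EqOpens τ} (k : Y ⟶ U) (_ : R k) (g : ZMod 2),
    F.obj.obj (op (translate τ g Y.toOpens)) := fun k hk => s k hk
  have hs' : ∀ {Y Z : EqOpens τ} (k : Y ⟶ U) (hk : R k) (l : Z ⟶ Y) (g : ZMod 2),
      s' (l ≫ k) (R.downward_closed hk l) g =
        F.obj.map (homOfLE (translate_le l g)).op (s' k hk (EqOpens.Hom.label l + g)) := by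
    intro Y Z k hk l g
    have h := hs (𝟙 Z) l (R.downward_closed hk l) hk (by simp)
    have h' := congrFun (show (coindPresheaf τ F.obj).map (𝟙 Z).op
      (s' (l ≫ k) (R.downward_closed hk l)) = (coindPresheaf τ F.obj).map l.op (s' k hk) from h) g
    rw [op_id, (coindPresheaf τ F.obj).map_id] at h'
    exact h'
  have hsc : ∀ {Y : EqOpens τ} {k k' : Y ⟶ U} (e : k = k') (hk : R k) (hk' : R k'),
      s' k hk = s' k' hk' := by
    rintro Y k _ rfl _ _
    rfl
  -- for each `g`, the open subsets of `g⁻¹ U` which `g` maps into `U` along `R`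
  let T (g : ZMod 2) : Sieve (translate τ g U.toOpens) :=
    { arrows := fun W f => R ((EqOpens.incl τ).map f ≫ translateHom g U)
      downward_closed := fun {Y Z f} hf j => by
        rw [Functor.map_comp, Category.assoc]
        exact R.downward_closed hf _ }
  have hT : ∀ g, T g ∈ Opens.grothendieckTopology M (translate τ g U.toOpens) := fun g x hx => by
    obtain ⟨V, hV, hxV, hRV⟩ := hR _ (mem_translate.1 hx)
    refine ⟨translate τ g V, homOfLE (translate_mono hV), ?_, hxV⟩
    have e : (EqOpens.incl τ).map (homOfLE (translate_mono (g := g) hV)) ≫ translateHom g U =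
        translateHom g ((EqOpens.incl τ).obj V) ≫ (EqOpens.incl τ).map (homOfLE hV) :=
      EqOpens.hom_ext (add_comm g 0)
    change R _
    rw [e]
    exact R.downward_closed hRV _
  let t (g : ZMod 2) : Presieve.FamilyOfElements (F.obj ⋙ forget AddCommGrpCat.{u}) (T g).arrows :=
    fun W f hf => s' _ hf 0
  have htc : ∀ g, (t g).Compatible := fun g => by
    rw [Presieve.compatible_iff_sieveCompatible]
    intro W W' f j hf
    refine (congrFun (hsc ?_ _ (R.downward_closed hf ((EqOpens.incl τ).map j))) 0).trans
      (hs' _ hf ((EqOpens.incl τ).map j) 0)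
    rw [Functor.map_comp, Category.assoc]
  choose a ha hau using fun g => hF (T g) (hT g) (t g) (htc g)
  refine ⟨a, fun Y k hk => ?_, fun b hb => ?_⟩
  · refine funext fun g => ?_
    have hf : R ((EqOpens.incl τ).map (homOfLE (translate_le k g)) ≫
        translateHom (EqOpens.Hom.label k + g) U) :=
      translateHom_comp k g ▸ R.downward_closed hk _
    refine (ha (EqOpens.Hom.label k + g) (homOfLE (translate_le k g)) hf).trans ?_
    refine (congrFun (hsc (translateHom_comp k g).symm _ (R.downward_closed hk _)) 0).trans ?_
    refine (hs' k hk (translateHom g Y) 0).trans ?_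
    exact (map_congr_index F.obj (s' k hk) (add_zero g) _ le_rfl).trans (map_refl_apply F.obj _ _)
  · refine funext fun g => hau g (b g) fun W f hf => ?_
    have h := congrFun (show (coindPresheaf τ F.obj).map _ b = s' _ hf from hb _ hf) 0
    refine Eq.trans ?_ h
    have e : g = EqOpens.Hom.label ((EqOpens.incl τ).map f ≫ translateHom g U) + 0 := by
      change g = g + 0 + 0
      simp
    exact map_congr_index F.obj b e f.le _

variable (τ) in
/-- The coinduction functor from sheaves on `M` to `ℤ/2`-sheaves. -/
def coind : AbSheaf M ⥤ Z2Sheaf τ where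
  obj F := ⟨coindPresheaf τ F.obj, isSheaf_coindPresheaf F⟩
  map {F G} φ := ObjectProperty.homMk
    { app := fun U => AddCommGrpCat.ofHom (AddMonoidHom.mk'
        (fun (a : ∀ g : ZMod 2, F.obj.obj (op (translate τ g U.unop.toOpens))) g =>
          φ.hom.app _ (a g))
        fun a b => funext fun g => map_add (φ.hom.app _).hom _ _)
      naturality := fun U V k => by
        refine ConcreteCategory.hom_ext _ _ fun a => funext fun g => ?_
        exact naturality_apply' φ.hom _ _ }

/-- The unit of the adjunction between the forgetful functor and coinduction. -/
def coindUnit (F : Z2Sheaf τ) : F ⟶ (coind τ).obj ((forgetAction τ).obj F) :=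
  ObjectProperty.homMk
    { app := fun U => AddCommGrpCat.ofHom (AddMonoidHom.mk'
        (fun s (g : ZMod 2) => F.obj.map (translateHom g U.unop).op s)
        fun a b => funext fun g => map_add (F.obj.map _).hom _ _)
      naturality := fun U V k => by
        refine ConcreteCategory.hom_ext _ _ fun a => funext fun g => ?_
        change F.obj.map _ (F.obj.map k a) = F.obj.map _ (F.obj.map _ a)
        rw [← ConcreteCategory.comp_apply, ← ConcreteCategory.comp_apply, ← F.obj.map_comp,
          ← F.obj.map_comp]
        exact congrArg (fun q => F.obj.map (Quiver.Hom.op q) a) (translateHom_comp k.unop g) }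

/-- The counit of the adjunction between the forgetful functor and coinduction. -/
def coindCounit (F : AbSheaf M) : (forgetAction τ).obj ((coind τ).obj F) ⟶ F :=
  ObjectProperty.homMk
    { app := fun U => AddCommGrpCat.ofHom (AddMonoidHom.mk'
        (fun a : ∀ g : ZMod 2, F.obj.obj (op (translate τ g U.unop)) => a 0)
        fun _ _ => rfl)
      naturality := fun _ _ _ => rfl }

variable (τ) in
/-- Coinduction is right adjoint to forgetting the action. -/
def forgetCoindAdj : forgetAction τ ⊣ coind τ :=
  Adjunction.mkOfUnitCounit
    { unit :=
        { app := coindUnit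
          naturality := fun F G φ => by
            ext U a
            refine funext fun g => ?_
            exact (naturality_apply' φ.hom _ _).symm }
      counit :=
        { app := coindCounit
          naturality := fun F G φ => rfl }
      left_triangle := by
        ext F U a
        exact ConcreteCategory.congr_hom (F.obj.map_id _) a
      right_triangle := by
        ext F U a
        refine funext fun g => ?_
        exact (map_congr_index F.obj a (add_zero g) _ le_rfl).trans (map_refl_apply F.obj _ _) }

instance : (coind τ).IsRightAdjoint := (forgetCoindAdj τ).isRightAdjoint

instance : (coind τ).Additive := (forgetCoindAdj τ).right_adjoint_additive

lemma exists_local_lift {F G : AbSheaf M} (φ : F ⟶ G) [Epi φ] {U : Opens M} (b : G.obj.obj (op U))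
    {x : M} (hx : x ∈ U) : ∃ (V : Opens M) (h : V ≤ U) (a : F.obj.obj (op V)), x ∈ V ∧
      φ.hom.app _ a = G.obj.map (homOfLE h).op b := by
  have hφ : Sheaf.IsLocallySurjective φ := by
    rw [Sheaf.isLocallySurjective_iff_epi']
    infer_instance
  obtain ⟨V, f, ⟨a, ha⟩, hxV⟩ := hφ.imageSieve_mem b x hx
  exact ⟨V, f.le, a, hxV, ha⟩

lemma act_act (g : ZMod 2) (x : M) : τ.act g (τ.act g x) = x := by
  rw [← τ.act_add, CharTwo.add_self_eq_zero, τ.act_zero]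

instance : (coind τ).PreservesEpimorphisms where
  preserves {F G} φ hφ := by
    rw [← Sheaf.isLocallySurjective_iff_epi']
    constructor
    intro U b x hx
    let b' : ∀ g : ZMod 2, G.obj.obj (op (translate τ g U.toOpens)) := b
    have hx' : ∀ g, τ.act g x ∈ translate τ g U.toOpens := fun g => by
      rwa [mem_translate, act_act]
    choose W hW a hxW ha using fun g => exists_local_lift φ (b' g) (hx' g)
    let V : Opens M := ⟨(⋂ g, τ.act g ⁻¹' W g) ∩ U.toOpens, (isOpen_iInter_of_finite fun g =>
      (W g).isOpen.preimage (τ.contMDiff_act g).continuous).inter U.toOpens.isOpen⟩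
    have hVW : ∀ g, translate τ g V ≤ W g := fun g y hy => by
      have h := Set.mem_iInter.1 (mem_translate.1 hy).1 g
      rwa [Set.mem_preimage, act_act] at h
    refine ⟨V, fun y hy => hy.2, ⟨Set.mem_iInter.2 hxW, hx⟩,
      (fun g => F.obj.map (homOfLE (hVW g)).op (a g) :
        ∀ g, F.obj.obj (op (translate τ g V))), ?_⟩
    refine funext fun g => ?_
    refine (naturality_apply' φ.hom _ _).trans ?_
    refine (congrArg (G.obj.map (homOfLE (hVW g)).op) (ha g)).trans ?_
    refine (map_map_apply G.obj _ _ _).trans ?_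
    exact map_congr_index G.obj b' (zero_add g).symm _ _

instance : Limits.PreservesFiniteLimits (coind τ) :=
  by
  have := (forgetCoindAdj τ).rightAdjoint_preservesLimits.{0, 0}
  exact Limits.PreservesLimitsOfSize.preservesFiniteLimits.{0, 0} (coind τ)

instance : Limits.PreservesFiniteColimits (coind τ) :=
  (coind τ).preservesFiniteColimits_iff_forall_exact_map_and_epi.2 fun S hS =>
    ⟨((coind τ).preservesFiniteLimits_iff_forall_exact_map_and_mono.1 inferInstance S hS).1,
      have := hS.epi_g
      inferInstance⟩

end Coinduction

section ConstantSheaf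

variable {C D : Type u} [SmallCategory C] [SmallCategory D] {J : GrothendieckTopology C}
  {K : GrothendieckTopology D} (G : C ⥤ D) [G.IsContinuous J K] [G.IsCocontinuous J K]

instance isIso_constComparison (A : AddCommGrpCat.{u}) :
    IsIso (constComparison (J := J) (K := K) G A) := by
  let P : Dᵒᵖ ⥤ AddCommGrpCat.{u} := (Functor.const _).obj A
  let α := (G.pushforwardContinuousSheafificationCompatibility AddCommGrpCat.{u} J K).app P
  suffices h : constComparison (J := J) (K := K) G A = α.hom from h ▸ α.isIso_hom
  apply ((sheafificationAdjunction J AddCommGrpCat.{u}).homEquiv _ _).injective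
  refine (((sheafificationAdjunction J AddCommGrpCat.{u}).homEquiv _ _).apply_symm_apply _).trans ?_
  refine (G.toSheafify_pullbackSheafificationCompatibility AddCommGrpCat.{u} J K P).symm.trans ?_
  exact (Adjunction.homEquiv_unit (sheafificationAdjunction J AddCommGrpCat.{u}) _ _ α.hom).symm

end ConstantSheaf

section ExtIso

universe w v u₀

variable {C : Type u₀} [Category.{v} C] [Abelian C] [HasExt.{w} C]

lemma bijective_comp_mk₀ (X : C) {Y Z : C} (f : Y ⟶ Z) [IsIso f] (n : ℕ) :
    Function.Bijective (fun x : Ext.{w} X Y n => x.comp (Ext.mk₀ f) (add_zero n)) :=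
  Function.bijective_iff_has_inverse.2 ⟨fun x => x.comp (Ext.mk₀ (inv f)) (add_zero n),
    fun x => by simp, fun x => by simp⟩

lemma bijective_mk₀_comp {X Y : C} (f : X ⟶ Y) [IsIso f] (Z : C) (n : ℕ) :
    Function.Bijective (fun x : Ext.{w} Y Z n => (Ext.mk₀ f).comp x (zero_add n)) :=
  Function.bijective_iff_has_inverse.2 ⟨fun x => (Ext.mk₀ (inv f)).comp x (zero_add n),
    fun x => by simp, fun x => by simp⟩

end ExtIso

section Shapiro

variable {E : Type*} [NormedAddCommGroup E] [NormedSpace ℝ E]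
  {H : Type*} [TopologicalSpace H] {I : ModelWithCorners ℝ E H}
  {M : Type u} [TopologicalSpace M] [ChartedSpace H M] {τ : SmoothInvolution I M}
  {A : Type} [AddCommGroup A] (F : FunctionClass τ A)

/-- The first projection from the induced to the trivial coefficients, on underlying sheaves. -/
def FunctionClass.fst :
    (forgetAction τ).obj F.induced.sheaf ⟶ (forgetAction τ).obj F.trivial.sheaf :=
  Coefficients.Hom.toSheafHom (S := F.induced) (T := F.trivial)
    { toHom := AddMonoidHom.fst _ _, comp_mem := fun hf => hf.1 }

/-- The comparison of the sheaf of pairs of functions with the coinduced sheaf. -/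
def FunctionClass.toCoind :
    F.induced.sheaf ⟶ (coind τ).obj ((forgetAction τ).obj F.trivial.sheaf) :=
  coindUnit _ ≫ (coind τ).map F.fst

instance : IsIso F.toCoind := by
  have h : ∀ U, IsIso (F.toCoind.hom.app U) := by
    intro U
    rw [ConcreteCategory.isIso_iff_bijective]
    refine ⟨fun f f' h => Subtype.ext (funext fun x => Prod.ext ?_ ?_), fun a => ?_⟩
    · exact congrFun (congrArg Subtype.val (congrFun
        (show (_ : ∀ g, F.sections (translate τ g U.unop.toOpens)) = _ from h) 0)) ⟨x.1, x.2⟩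
    · have hx : τ.act 1 (τ.act 1 x.1) ∈ U.unop.toOpens := by
        rw [act_act]
        exact x.2
      have h1 := congrFun (congrArg Subtype.val (congrFun
        (show (_ : ∀ g, F.sections (translate τ g U.unop.toOpens)) = _ from h) 1))
        ⟨τ.act 1 x.1, hx⟩
      have e : (⟨τ.act 1 (τ.act 1 x.1), hx⟩ : U.unop.toOpens) = x := Subtype.ext (act_act (τ := τ) 1 x.1)
      have h2 : (f.1 ⟨τ.act 1 (τ.act 1 x.1), hx⟩).2 = (f'.1 ⟨τ.act 1 (τ.act 1 x.1), hx⟩).2 := h1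
      rwa [e] at h2
    · let a' : ∀ g, F.sections (translate τ g U.unop.toOpens) := a
      have hx : ∀ x ∈ U.unop.toOpens, τ.act 1 x ∈ translate τ 1 U.unop.toOpens := fun x hx => by
        rwa [mem_translate, act_act]
      refine ⟨(⟨fun x => ((a' 0).1 ⟨x.1, x.2⟩, (a' 1).1 ⟨τ.act 1 x.1, hx _ x.2⟩), (a' 0).2,
        F.comp_act 1 hx (a' 1).2⟩ : F.prod.sections U.unop.toOpens), ?_⟩
      have h2 : ∀ k : ZMod 2, k = 0 ∨ k = 1 := by decide
      refine funext fun g => ?_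
      obtain rfl | rfl := h2 g
      · rfl
      · refine Subtype.ext (funext fun x => ?_)
        exact congrArg (a' 1).1 (Subtype.ext (act_act (τ := τ) 1 x.1))
  have : IsIso F.toCoind.hom := NatIso.isIso_of_isIso_app _
  have : IsIso ((sheafToPresheaf _ _).map F.toCoind) := this
  exact isIso_of_reflects_iso F.toCoind (sheafToPresheaf _ _)

lemma FunctionClass.toCoind_comp_counit :
    (forgetAction τ).map F.toCoind ≫ coindCounit _ = F.fst := by
  ext U f
  rfl

/-- Shapiro's lemma: forgetting equivariance and projecting to the first summand is an
isomorphism. -/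
lemma FunctionClass.bijective_fst_forgetEquivariance (n : ℕ) :
    Function.Bijective ((Sheaf.H.map F.fst n).comp (forgetEquivariance F.induced.sheaf n)) := by
  let c := constComparison (J := Opens.grothendieckTopology M) (K := EqOpens.topology τ)
    (EqOpens.incl τ) (AddCommGrpCat.of (ULift.{u} ℤ))
  have h1 := bijective_comp_mk₀ ((constantSheaf (EqOpens.topology τ) AddCommGrpCat.{u}).obj
    (AddCommGrpCat.of (ULift.{u} ℤ))) F.toCoind n
  have h2 := bijective_mapExactFunctor_comp_counit (forgetCoindAdj τ)
    ((constantSheaf (EqOpens.topology τ) AddCommGrpCat.{u}).obj (AddCommGrpCat.of (ULift.{u} ℤ)))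
    ((forgetAction τ).obj F.trivial.sheaf) n
  have h3 := bijective_mk₀_comp c ((forgetAction τ).obj F.trivial.sheaf) n
  convert! h3.comp (h2.comp h1) using 1
  ext x
  change ((Ext.mk₀ c).comp (x.mapExactFunctor (forgetAction τ)) (zero_add n)).comp (Ext.mk₀ F.fst)
    (add_zero n) = (Ext.mk₀ c).comp (((x.comp (Ext.mk₀ F.toCoind) (add_zero n)).mapExactFunctor
      (forgetAction τ)).comp (Ext.mk₀ (coindCounit _)) (add_zero n)) (zero_add n)
  rw [Ext.mapExactFunctor_comp, Ext.mapExactFunctor_mk₀, Ext.comp_assoc_of_third_deg_zero,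
    Ext.comp_assoc_of_third_deg_zero, Ext.mk₀_comp_mk₀, F.toCoind_comp_counit]

end Shapiro

section Stalks

variable {M : Type u} [TopologicalSpace M]

/-- The stalk at `x` of a presheaf of abelian groups on `M`. -/
def stalkAt (F : (Opens M)ᵒᵖ ⥤ AddCommGrpCat.{u}) (x : M) : AddCommGrpCat.{u} :=
  TopCat.Presheaf.stalk (X := TopCat.of M) F x

/-- The germ at `x` of a section over a neighbourhood of `x`. -/
def germAt (F : (Opens M)ᵒᵖ ⥤ AddCommGrpCat.{u}) {U : Opens M} {x : M} (hx : x ∈ U) :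
    F.obj (op U) ⟶ stalkAt F x :=
  TopCat.Presheaf.germ (X := TopCat.of M) F U x hx

/-- The map on stalks induced by a morphism of presheaves. -/
def stalkMap {F G : (Opens M)ᵒᵖ ⥤ AddCommGrpCat.{u}} (φ : F ⟶ G) (x : M) :
    stalkAt F x ⟶ stalkAt G x :=
  (TopCat.Presheaf.stalkFunctor (X := TopCat.of M) AddCommGrpCat.{u} x).map φ

variable {F G : (Opens M)ᵒᵖ ⥤ AddCommGrpCat.{u}}

lemma germAt_map {U V : Opens M} (h : V ≤ U) {x : M} (hx : x ∈ V) (s : F.obj (op U)) :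
    germAt F hx (F.map (homOfLE h).op s) = germAt F (h hx) s :=
  TopCat.Presheaf.germ_res_apply (X := TopCat.of M) F (homOfLE h) x hx s

lemma exists_germAt_eq {x : M} {V : Opens M} (hV : x ∈ V) (t : stalkAt F x) :
    ∃ (U : Opens M) (_ : U ≤ V) (hx : x ∈ U) (s : F.obj (op U)), germAt F hx s = t := by
  obtain ⟨U, h, hx, s, hs⟩ :=
    TopCat.Presheaf.exists_le_germ_eq (X := TopCat.of M) F (x := x) t (V := V) hV
  exact ⟨U, h, hx, s, hs⟩

lemma stalkMap_germAt (φ : F ⟶ G) {U : Opens M} {x : M} (hx : x ∈ U) (s : F.obj (op U)) :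
    stalkMap φ x (germAt F hx s) = germAt G hx (φ.app _ s) :=
  TopCat.Presheaf.stalkFunctor_map_germ_apply (X := TopCat.of M) U x hx φ s

lemma section_ext_germAt (F : AbSheaf M) {U : Opens M} {s t : F.obj.obj (op U)}
    (h : ∀ (x : M) (hx : x ∈ U), germAt F.obj hx s = germAt F.obj hx t) : s = t :=
  TopCat.Presheaf.section_ext (X := TopCat.of M) F U s t h

lemma eq_of_locally_eq (F : AbSheaf M) {U : Opens M} {s t : F.obj.obj (op U)}
    (h : ∀ x ∈ U, ∃ (V : Opens M) (hV : V ≤ U), x ∈ V ∧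
      F.obj.map (homOfLE hV).op s = F.obj.map (homOfLE hV).op t) : s = t :=
  section_ext_germAt F fun x hx => by
    obtain ⟨V, hV, hxV, e⟩ := h x hx
    rw [← germAt_map hV hxV, e, germAt_map]

variable {x : M} {A : AddCommGrpCat.{u}} (φ : ∀ (U : Opens M), x ∈ U → (F.obj (op U) ⟶ A))
  (hφ : ∀ (U V : Opens M) (h : V ≤ U) (hx : x ∈ V), F.map (homOfLE h).op ≫ φ V hx = φ U (h hx))

/-- The cocone under the diagram of sections near `x` defined by a compatible family. -/
def stalkCocone : Limits.Cocone ((OpenNhds.inclusion (X := TopCat.of M) x).op ⋙ F) where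
  pt := A
  ι :=
    { app := fun U => φ U.unop.1 U.unop.2
      naturality := fun U V k => by
        refine (hφ U.unop.1 V.unop.1 (leOfHom k.unop) V.unop.2).trans ?_
        exact (Category.comp_id _).symm }

/-- The morphism from a stalk defined by a compatible family of morphisms. -/
def stalkDesc : stalkAt F x ⟶ A :=
  Limits.colimit.desc ((OpenNhds.inclusion (X := TopCat.of M) x).op ⋙ F) (stalkCocone φ hφ)

lemma stalkDesc_germAt {U : Opens M} (hx : x ∈ U) (s : F.obj (op U)) :
    stalkDesc φ hφ (germAt F hx s) = φ U hx s :=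
  ConcreteCategory.congr_hom (Limits.colimit.ι_desc (stalkCocone φ hφ)
    (op (⟨U, hx⟩ : OpenNhds (X := TopCat.of M) x))) s

end Stalks

section Godement

variable {M : Type u} [TopologicalSpace M]

/-- The sheaf on `M` of all families of elements of the groups `J x`. -/
def godement (J : M → AddCommGrpCat.{u}) : AbSheaf M where
  obj :=
    { obj := fun U => AddCommGrpCat.of (∀ x : U.unop, J x)
      map := fun {U V} k => AddCommGrpCat.ofHom (AddMonoidHom.mk'
        (fun s (x : V.unop) => s ⟨x, k.unop.le x.2⟩) fun _ _ => rfl) }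
  property := by
    rw [Presheaf.isSheaf_iff_isSheaf_forget _ _ (forget AddCommGrpCat.{u})]
    exact TopCat.Presheaf.toTypes_isSheaf (TopCat.of M) fun x => J x

/-- The morphism between sheaves of families induced by homomorphisms at each point. -/
def godementMap {J J' : M → AddCommGrpCat.{u}} (φ : ∀ x, J x ⟶ J' x) : godement J ⟶ godement J' :=
  ObjectProperty.homMk
    { app := fun U => AddCommGrpCat.ofHom (AddMonoidHom.mk'
        (fun (s : ∀ x : U.unop, J x) (x : U.unop) => φ x (s x))
        fun _ _ => funext fun _ => map_add (φ _).hom _ _)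
      naturality := fun _ _ _ => rfl }

/-- The morphism to a sheaf of families induced by homomorphisms on the stalks. -/
def toGodement {F : AbSheaf M} {J : M → AddCommGrpCat.{u}} (φ : ∀ x, stalkAt F.obj x ⟶ J x) :
    F ⟶ godement J :=
  ObjectProperty.homMk
    { app := fun U => AddCommGrpCat.ofHom (AddMonoidHom.mk'
        (fun s (x : U.unop) => φ x (germAt F.obj x.2 s))
        fun _ _ => funext fun _ => by rw [map_add, map_add]; rfl)
      naturality := fun U V k => by
        refine ConcreteCategory.hom_ext _ _ fun s => funext fun x => ?_
        exact congrArg (φ x) (germAt_map k.unop.le x.2 s) }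

instance (F : AbSheaf M) : Mono (toGodement fun x => 𝟙 (stalkAt F.obj x)) := by
  have : ∀ U, Mono ((toGodement fun x => 𝟙 (stalkAt F.obj x)).hom.app U) := fun U => by
    rw [AddCommGrpCat.mono_iff_injective]
    intro s t h
    exact section_ext_germAt F fun x hx => congrFun
      (show (_ : ∀ x : U.unop, stalkAt F.obj x) = _ from h) ⟨x, hx⟩
  have : Mono (toGodement fun x => 𝟙 (stalkAt F.obj x)).hom := NatTrans.mono_of_mono_app _
  exact Sheaf.Hom.mono_of_presheaf_mono _ _ _

instance (J : M → AddCommGrpCat.{u}) [∀ x, Injective (J x)] : Injective (godement J) where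
  factors {F G} g f hf := by
    have hm : ∀ x, Mono (stalkMap f.hom x) := fun x => by
      have : Mono (C := TopCat.Sheaf AddCommGrpCat.{u} (TopCat.of M)) f := hf
      exact TopCat.Presheaf.stalk_mono_of_mono (X := TopCat.of M) f x
    let γ (x : M) : stalkAt F.obj x ⟶ J x := stalkDesc
      (fun U hx => g.hom.app (op U) ≫ AddCommGrpCat.ofHom (AddMonoidHom.mk'
        (fun s : ∀ x : U, J x => s ⟨x, hx⟩) fun _ _ => rfl))
      fun U V h hx => by
        refine ConcreteCategory.hom_ext _ _ fun s => ?_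
        exact congrFun (show (_ : ∀ x : V, J x) = _ from
          naturality_apply' g.hom (homOfLE h).op s) ⟨x, hx⟩
    refine ⟨toGodement fun x => Injective.factorThru (γ x) (stalkMap f.hom x), ?_⟩
    ext U s
    refine funext fun x => ?_
    have h1 := ConcreteCategory.congr_hom
      (Injective.comp_factorThru (γ x) (stalkMap f.hom x)) (germAt F.obj x.2 s)
    rw [ConcreteCategory.comp_apply, stalkMap_germAt] at h1
    exact h1.trans (stalkDesc_germAt _ _ _ _)

end Godement

section FineSheaves

variable {E : Type*} [NormedAddCommGroup E] [NormedSpace ℝ E]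
  {H : Type*} [TopologicalSpace H] {I : ModelWithCorners ℝ E H}
  {M : Type u} [TopologicalSpace M] [ChartedSpace H M]

variable (I) in
/-- A fine structure on a sheaf of abelian groups on `M`: smooth functions act additively on it by
endomorphisms, locally on `M`. -/
structure FineAction (F : AbSheaf M) where
  act : C^∞⟮I, M; 𝓘(ℝ, ℝ), ℝ⟯ →+ (F ⟶ F)
  act_one : act 1 = 𝟙 F
  act_eq_zero : ∀ (f : C^∞⟮I, M; 𝓘(ℝ, ℝ), ℝ⟯) (U : Opens M), (∀ x ∈ U, f x = 0) →
    ∀ s : F.obj.obj (op U), (act f).hom.app _ s = 0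

namespace FineAction

variable {F : AbSheaf M} (a : FineAction I F)

include a in
lemma exists_zsmul_eq {U : Opens M} {n : ℤ} (hn : n ≠ 0) (s : F.obj.obj (op U)) :
    ∃ t, n • t = s := by
  let c : C^∞⟮I, M; 𝓘(ℝ, ℝ), ℝ⟯ := algebraMap ℝ _ (n : ℝ)⁻¹
  have hc : n • c = 1 := by
    have h : n • c = algebraMap ℝ C^∞⟮I, M; 𝓘(ℝ, ℝ), ℝ⟯ (n • (n : ℝ)⁻¹) := (map_zsmul _ _ _).symm
    rw [h, zsmul_eq_mul, mul_inv_cancel₀ (Int.cast_ne_zero.2 hn), map_one]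
  refine ⟨(a.act c).hom.app _ s, ?_⟩
  have h : n • a.act c = 𝟙 F := by rw [← map_zsmul, hc, a.act_one]
  exact congrArg (fun q : F ⟶ F => q.hom.app (op U) s) h

include a in
lemma injective_stalkAt (x : M) : Injective (stalkAt F.obj x) := by
  have : DivisibleBy (stalkAt F.obj x) ℤ := divisibleByOfSMulRightSurj _ _ fun {n} hn t => by
    obtain ⟨U, -, hx, s, rfl⟩ := exists_germAt_eq (V := ⊤) trivial t
    obtain ⟨r, rfl⟩ := a.exists_zsmul_eq hn s
    exact ⟨germAt F.obj hx r, (map_zsmul (germAt F.obj hx).hom n r).symm⟩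
  exact AddCommGrpCat.injective_of_divisible (stalkAt F.obj x)

/-- The fine structure on the sheaf of families of germs. -/
def godement : FineAction I (godement (stalkAt F.obj)) where
  act := AddMonoidHom.mk' (fun f => godementMap (stalkMap (a.act f).hom)) fun f g => by
    ext U s
    refine funext fun x => ?_
    obtain ⟨V, -, hx, t, ht⟩ := exists_germAt_eq (V := U.unop) x.2
      ((show ∀ x : U.unop, stalkAt F.obj x from s) x)
    change stalkMap (a.act (f + g)).hom x (_ : stalkAt F.obj x) =
      stalkMap (a.act f).hom x (_ : stalkAt F.obj x) +
        stalkMap (a.act g).hom x (_ : stalkAt F.obj x)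
    rw [← ht, stalkMap_germAt, stalkMap_germAt, stalkMap_germAt, ← map_add, map_add a.act]
    rfl
  act_one := by
    ext U s
    refine funext fun x => ?_
    obtain ⟨V, -, hx, t, ht⟩ := exists_germAt_eq (V := U.unop) x.2
      ((show ∀ x : U.unop, stalkAt F.obj x from s) x)
    change stalkMap (a.act 1).hom x (_ : stalkAt F.obj x) = _
    rw [← ht, stalkMap_germAt, a.act_one]
    exact ht
  act_eq_zero f U hf s := by
    refine funext fun x => ?_
    obtain ⟨V, hV, hx, t, ht⟩ := exists_germAt_eq (V := U) x.2
      ((show ∀ x : U, stalkAt F.obj x from s) x)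
    change stalkMap (a.act f).hom x (_ : stalkAt F.obj x) = 0
    rw [← ht, stalkMap_germAt, a.act_eq_zero f V fun y hy => hf y (hV hy), map_zero]

/-- A fine structure descends along an epimorphism. -/
def ofEpi {G : AbSheaf M} (π : F ⟶ G) [Epi π]
    (b : C^∞⟮I, M; 𝓘(ℝ, ℝ), ℝ⟯ → (G ⟶ G)) (hb : ∀ f, π ≫ b f = a.act f ≫ π) : FineAction I G where
  act := AddMonoidHom.mk' b fun f g => by
    rw [← cancel_epi π, Preadditive.comp_add, hb, hb, hb, map_add, Preadditive.add_comp]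
  act_one := by
    change b 1 = _
    rw [← cancel_epi π, hb, a.act_one, Category.id_comp, Category.comp_id]
  act_eq_zero f U hf s := by
    change (b f).hom.app _ s = 0
    refine eq_of_locally_eq G fun x hx => ?_
    obtain ⟨V, hV, t, hxV, ht⟩ := exists_local_lift π s hx
    refine ⟨V, hV, hxV, ?_⟩
    rw [map_zero, ← naturality_apply', ← ht]
    refine (congrArg (fun q : F ⟶ G => q.hom.app (op V) t) (hb f)).trans ?_
    change π.hom.app _ ((a.act f).hom.app _ t) = 0
    rw [a.act_eq_zero f V (fun y hy => hf y (hV hy)), map_zero]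

/-- By a partition of unity, global sections lift along a fine epimorphism from a sheaf of
families. -/
lemma exists_global_lift [FiniteDimensional ℝ E] [IsManifold I ∞ M] [T2Space M]
    [SigmaCompactSpace M] {J : M → AddCommGrpCat.{u}} {Q : AbSheaf M}
    (a : FineAction I (RealGerbe.godement J)) (b : FineAction I Q) (π : RealGerbe.godement J ⟶ Q)
    [Epi π] (hπ : ∀ f, π ≫ b.act f = a.act f ≫ π) (q : Q.obj.obj (op ⊤)) :
    ∃ t, π.hom.app (op ⊤) t = q := by
  classical
  choose U hU s hxU hs using fun x : M => exists_local_lift π q (U := ⊤) (x := x) trivial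
  obtain ⟨ρ, hρ⟩ := SmoothPartitionOfUnity.exists_isSubordinate I isClosed_univ
    (fun x => (U x : Set M)) (fun x => (U x).isOpen) fun x _ => Set.mem_iUnion.2 ⟨x, hxU x⟩
  let s' (i : M) : (RealGerbe.godement J).obj.obj (op ⊤) := fun x : (⊤ : Opens M) =>
    if h : x.1 ∈ U i then (show ∀ x : U i, J x from s i) ⟨x.1, h⟩ else 0
  have hs' : ∀ i, (RealGerbe.godement J).obj.map (homOfLE (hU i)).op (s' i) = s i := fun i =>
    funext fun x => dif_pos x.2
  have hπs : ∀ i, π.hom.app (op ⊤) ((a.act (ρ i)).hom.app _ (s' i)) = (b.act (ρ i)).hom.app _ q := by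
    intro i
    have h1 : π.hom.app (op ⊤) ((a.act (ρ i)).hom.app _ (s' i)) =
        (b.act (ρ i)).hom.app _ (π.hom.app _ (s' i)) :=
      congrArg (fun p : RealGerbe.godement J ⟶ Q => p.hom.app (op ⊤) (s' i)) (hπ (ρ i)).symm
    rw [h1, ← sub_eq_zero, ← map_sub]
    refine eq_of_locally_eq Q fun x _ => ?_
    by_cases hx : x ∈ U i
    · refine ⟨U i, le_top, hx, ?_⟩
      rw [map_zero, ← naturality_apply', map_sub, ← naturality_apply', hs', hs, sub_self, map_zero]
    · refine ⟨⟨(tsupport (ρ i))ᶜ, (isClosed_tsupport _).isOpen_compl⟩, le_top,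
        fun h => hx (hρ i h), ?_⟩
      rw [map_zero, ← naturality_apply']
      exact b.act_eq_zero _ _ (fun y hy => image_eq_zero_of_notMem_tsupport hy) _
  let r (i : M) : (RealGerbe.godement J).obj.obj (op ⊤) := (a.act (ρ i)).hom.app _ (s' i)
  let t : (RealGerbe.godement J).obj.obj (op ⊤) := fun x : (⊤ : Opens M) =>
    ∑ᶠ i, (show ∀ x : (⊤ : Opens M), J x from r i) x
  refine ⟨t, eq_of_locally_eq Q fun x _ => ?_⟩
  obtain ⟨N, hN, hfin⟩ := ρ.locallyFinite x
  obtain ⟨V, hVN, hV, hxV⟩ := mem_nhds_iff.1 hN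
  let W : Opens M := ⟨V, hV⟩
  let S : Finset M := hfin.toFinset
  have hS : ∀ i ∉ S, ∀ y ∈ W, ρ i y = 0 := fun i hi y hy => by
    by_contra h
    exact hi (hfin.mem_toFinset.2 ⟨y, h, hVN hy⟩)
  have hr : ∀ i ∉ S, (RealGerbe.godement J).obj.map (homOfLE (le_top : W ≤ ⊤)).op (r i) = 0 :=
    fun i hi => (naturality_apply' (a.act (ρ i)).hom _ _).symm.trans (a.act_eq_zero _ _ (hS i hi) _)
  have ht : (RealGerbe.godement J).obj.map (homOfLE (le_top : W ≤ ⊤)).op t =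
      (RealGerbe.godement J).obj.map (homOfLE (le_top : W ≤ ⊤)).op (∑ i ∈ S, r i) := by
    refine funext fun y : W => ?_
    refine Eq.trans ?_ (Finset.sum_apply (⟨y.1, trivial⟩ : (⊤ : Opens M)) S
      fun i => (show ∀ x : (⊤ : Opens M), J x from r i)).symm
    refine finsum_eq_sum_of_support_subset _ fun i hi => ?_
    by_contra h
    exact hi (congrFun (show (_ : ∀ x : W, J x) = _ from hr i h) y)
  have hsum : ∀ y ∈ W, (∑ i ∈ S, ρ i - 1 : C^∞⟮I, M; 𝓘(ℝ, ℝ), ℝ⟯) y = 0 := by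
    intro y hy
    have h1 : ∑ᶠ i, ρ i y = 1 := ρ.sum_eq_one (Set.mem_univ y)
    rw [finsum_eq_sum_of_support_subset (s := S) _ fun i hi => by
      by_contra h
      exact hi (hS i h y hy)] at h1
    have h2 := congrFun (map_sum (ContMDiffMap.coeFnAddMonoidHom (I := I) (N := M) (n := ∞)
      (I' := 𝓘(ℝ, ℝ)) (G := ℝ)) (fun i => ρ i) S) y
    rw [Finset.sum_apply] at h2
    exact sub_eq_zero.2 (h2.trans h1)
  refine ⟨W, le_top, hxV, ?_⟩
  have h2 : (b.act (∑ i ∈ S, ρ i - 1)).hom.app (op W)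
      (Q.obj.map (homOfLE (le_top : W ≤ ⊤)).op q) = 0 := b.act_eq_zero _ _ hsum _
  have h3 : π.hom.app (op ⊤) (∑ i ∈ S, r i) = (b.act (∑ i ∈ S, ρ i)).hom.app (op ⊤) q := by
    rw [map_sum, map_sum, Finset.sum_congr rfl fun i _ => hπs i]
    let ev : (Q ⟶ Q) →+ Q.obj.obj (op ⊤) := AddMonoidHom.mk' (fun p => p.hom.app (op ⊤) q)
      fun _ _ => rfl
    exact (map_sum ev (fun i => b.act (ρ i)) S).symm
  rw [← naturality_apply', ht, naturality_apply', h3, ← naturality_apply']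
  rw [map_sub, b.act_one] at h2
  exact sub_eq_zero.1 h2

/-- Fine sheaves on a manifold are acyclic. -/
lemma subsingleton_H [FiniteDimensional ℝ E] [IsManifold I ∞ M] [T2Space M]
    [SigmaCompactSpace M] {F : AbSheaf M} (a : FineAction I F) (n : ℕ) :
    Subsingleton (Sheaf.H F (n + 1)) := by
  induction n using Nat.strong_induction_on generalizing F with | _ n ih => ?_
  have := a.injective_stalkAt
  let ι : F ⟶ RealGerbe.godement (stalkAt F.obj) := toGodement fun x => 𝟙 (stalkAt F.obj x)
  let S : ShortComplex (AbSheaf M) := .mk ι (Limits.cokernel.π ι) (Limits.cokernel.condition ι)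
  have hS : S.ShortExact :=
    { exact := ShortComplex.exact_of_g_is_cokernel _ (Limits.cokernelIsCokernel _)
      mono_f := inferInstanceAs (Mono ι)
      epi_g := inferInstanceAs (Epi (Limits.cokernel.π ι)) }
  have hι : ∀ f, ι ≫ a.godement.act f = a.act f ≫ ι := fun f => by
    ext U s
    exact funext fun x => stalkMap_germAt _ _ _
  let b : FineAction I (Limits.cokernel ι) := a.godement.ofEpi (Limits.cokernel.π ι)
    (fun f => Limits.cokernel.map ι ι (a.act f) (a.godement.act f) (hι f))
    fun f => Limits.cokernel.π_desc _ _ _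
  have hb : ∀ f, Limits.cokernel.π ι ≫ b.act f = a.godement.act f ≫ Limits.cokernel.π ι :=
    fun f => Limits.cokernel.π_desc _ _ _
  have hI : Injective S.X₂ := inferInstanceAs (Injective (RealGerbe.godement (stalkAt F.obj)))
  refine subsingleton_of_forall_eq 0 fun x => ?_
  obtain ⟨y, rfl⟩ := Ext.covariant_sequence_exact₁ _ hS x (Ext.eq_zero_of_injective _) rfl
  cases n with
  | zero =>
    have hT : Limits.IsTerminal (⊤ : Opens M) := Limits.isTerminalTop
    let y' : Sheaf.H (Limits.cokernel ι) 0 := y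
    obtain ⟨t, ht⟩ := exists_global_lift a.godement b (Limits.cokernel.π ι) hb
      (Sheaf.H.equiv₀ _ hT y')
    have h := Sheaf.H.equiv₀_symm_naturality hT (Limits.cokernel.π ι) t
    rw [ht, AddEquiv.symm_apply_apply] at h
    have h' : ((Sheaf.H.equiv₀ _ hT).symm t).comp (Ext.mk₀ S.g) (add_zero 0) = y := h
    rw [← h', Ext.comp_assoc_of_second_deg_zero, ShortComplex.ShortExact.comp_extClass,
      Ext.comp_zero]
  | succ n =>
    have hy : y = 0 := @Subsingleton.elim _ (ih n n.lt_succ_self b) y 0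
    rw [hy, Ext.zero_comp]

end FineAction

end FineSheaves

section Connecting

variable {C : Type u} [SmallCategory C] {J : GrothendieckTopology C}

lemma bijective_connecting {S : ShortComplex (Sheaf J AddCommGrpCat.{u})} (hS : S.ShortExact)
    (n : ℕ) (h : Subsingleton (Sheaf.H S.X₂ n)) (h' : Subsingleton (Sheaf.H S.X₂ (n + 1))) :
    Function.Bijective (connecting hS n) := by
  refine ⟨(injective_iff_map_eq_zero _).2 fun x hx => ?_, fun y => ?_⟩
  · obtain ⟨y, rfl⟩ := Ext.covariant_sequence_exact₃ _ hS x rfl hx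
    rw [@Subsingleton.elim _ h y 0, Ext.zero_comp]
  · exact Ext.covariant_sequence_exact₁ _ hS y (@Subsingleton.elim _ h' _ _) rfl

lemma map_eq_zero_iff_exists {S : ShortComplex (Sheaf J AddCommGrpCat.{u})} (hS : S.ShortExact)
    (n : ℕ) (y : Sheaf.H S.X₂ n) :
    Sheaf.H.map S.g n y = 0 ↔ ∃ x, Sheaf.H.map S.f n x = y := by
  refine ⟨fun h => Ext.covariant_sequence_exact₂ _ hS y h, ?_⟩
  rintro ⟨x, rfl⟩
  rw [← Sheaf.H.map_comp_apply, S.zero, Sheaf.H.map_apply, Ext.mk₀_zero, Ext.comp_zero]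

end Connecting

section Reals

variable {E : Type*} [NormedAddCommGroup E] [NormedSpace ℝ E]
  {H : Type*} [TopologicalSpace H] {I : ModelWithCorners ℝ E H}
  {M : Type u} [TopologicalSpace M] [ChartedSpace H M] {τ : SmoothInvolution I M}

variable (τ) in
/-- Smooth real functions act on the sheaf of smooth real functions by multiplication. -/
def realsFineAction : FineAction I ((forgetAction τ).obj (reals τ)) where
  act := AddMonoidHom.mk' (fun f => ObjectProperty.homMk
    { app := fun U => AddCommGrpCat.ofHom (AddMonoidHom.mk'
        (fun s : (realFunctions τ).sections U.unop =>
          (⟨fun x => f x * s.1 x, (f.contMDiff.comp contMDiff_subtype_val).mul s.2⟩ :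
            (realFunctions τ).sections U.unop))
        fun s t => Subtype.ext (funext fun x => mul_add _ _ _))
      naturality := fun _ _ _ => rfl }) fun f g => by
    ext U s
    exact Subtype.ext (funext fun x => add_mul _ _ _)
  act_one := by
    ext U s
    exact Subtype.ext (funext fun x => one_mul _)
  act_eq_zero f U hf s := Subtype.ext (funext fun x => by
    change f x * (show (realFunctions τ).sections U from s).1 x = 0
    rw [hf x x.2, zero_mul])

variable (τ) in
/-- The morphism `f ↦ (f / 2, f / 2)`. -/
def halfDiagonal : reals τ ⟶ (realFunctions τ).induced.sheaf :=
  Coefficients.Hom.toZ2SheafHom (S := (realFunctions τ).trivial) (T := (realFunctions τ).induced)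
    { toHom := (AddMonoidHom.mulLeft (1 / 2 : ℝ)).prod (AddMonoidHom.mulLeft (1 / 2 : ℝ))
      comp_mem := fun hf => ⟨contMDiff_const.mul hf, contMDiff_const.mul hf⟩ }
    fun _ => rfl

variable (τ) in
/-- The morphism `(f, h) ↦ f + h`. -/
def realSum : (realFunctions τ).induced.sheaf ⟶ reals τ :=
  Coefficients.Hom.toZ2SheafHom (S := (realFunctions τ).induced) (T := (realFunctions τ).trivial)
    { toHom := AddMonoidHom.fst ℝ ℝ + AddMonoidHom.snd ℝ ℝ
      comp_mem := fun {U _} hf => ((realFunctions τ).sections U).add_mem hf.1 hf.2 }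
    fun a => add_comm a.2 a.1

lemma halfDiagonal_realSum : halfDiagonal τ ≫ realSum τ = 𝟙 _ := by
  ext U f
  refine Subtype.ext (funext fun x => ?_)
  change 1 / 2 * (show (realFunctions τ).sections _ from f).1 x +
    1 / 2 * (show (realFunctions τ).sections _ from f).1 x = _
  rw [← add_mul, add_halves, one_mul]
  rfl

variable [FiniteDimensional ℝ E] [IsManifold I ∞ M] [T2Space M] [SigmaCompactSpace M]

variable (τ) in
lemma subsingleton_cohomology_reals (n : ℕ) : Subsingleton (Cohomology (reals τ) (n + 1)) :=
  (realsFineAction τ).subsingleton_H n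

variable (τ) in
lemma subsingleton_eqCohomology_reals (n : ℕ) :
    Subsingleton (EqCohomology (reals τ) (n + 1)) := by
  have := subsingleton_cohomology_reals τ n
  have h : Subsingleton (EqCohomology (realFunctions τ).induced.sheaf (n + 1)) :=
    ((realFunctions τ).bijective_fst_forgetEquivariance (n + 1)).injective.subsingleton
      (β := Cohomology (reals τ) (n + 1))
  refine subsingleton_of_forall_eq 0 fun x => ?_
  rw [← Sheaf.H.map_id_apply x, ← halfDiagonal_realSum, Sheaf.H.map_comp_apply,
    @Subsingleton.elim _ h (Sheaf.H.map (halfDiagonal τ) (n + 1) x) 0, map_zero]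

variable (τ) in
lemma bijective_bockstein (n : ℕ) : Function.Bijective (bockstein τ (n + 1)) :=
  bijective_connecting _ _ (subsingleton_cohomology_reals τ n)
    (subsingleton_cohomology_reals τ (n + 1))

variable (τ) in
lemma bijective_eqBockstein (n : ℕ) : Function.Bijective (eqBockstein τ (n + 1)) :=
  bijective_connecting _ _ (subsingleton_eqCohomology_reals τ n)
    (subsingleton_eqCohomology_reals τ (n + 1))

end Reals

section RealSequence

variable {E : Type*} [NormedAddCommGroup E] [NormedSpace ℝ E]
  {H : Type*} [TopologicalSpace H] {I : ModelWithCorners ℝ E H}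
  {M : Type u} [TopologicalSpace M] [ChartedSpace H M] {τ : SmoothInvolution I M}

variable (τ) in
/-- The morphism `f ↦ (f, f⁻¹)` from `U(1)-bar` to `𝒰(1) ⊕ τ⁻¹𝒰(1)`. -/
def antidiagonalHom : unitaryBar τ ⟶ unitaryInduced τ :=
  Coefficients.Hom.toZ2SheafHom (S := (circleFunctions τ).inverted)
    (T := (circleFunctions τ).induced)
    { toHom := (AddMonoidHom.id (Additive Circle)).prod negAddMonoidHom
      comp_mem := fun {U _} hf => ⟨hf, ((circleFunctions τ).sections U).neg_mem hf⟩ }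
    fun a => Prod.ext rfl (neg_neg a)

variable (τ) in
/-- The sequence `0 → U(1)-bar → 𝒰(1) ⊕ τ⁻¹𝒰(1) → 𝒰(1) → 0` of `ℤ/2`-sheaves. -/
def realSequence : ShortComplex (Z2Sheaf τ) where
  f := antidiagonalHom τ
  g := productHom τ
  zero := by
    ext U f
    exact Subtype.ext (funext fun x => add_neg_cancel _)

lemma realSequence_shortExact : (realSequence τ).ShortExact := by
  have hm : Mono (antidiagonalHom τ) := by
    have : ∀ U, Mono ((antidiagonalHom τ).hom.app U) := fun U => by
      rw [AddCommGrpCat.mono_iff_injective]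
      intro f g h
      refine Subtype.ext (funext fun x => ?_)
      exact congrArg Prod.fst (congrFun (congrArg Subtype.val h) x)
    have : Mono (antidiagonalHom τ).hom := NatTrans.mono_of_mono_app _
    exact Sheaf.Hom.mono_of_presheaf_mono _ _ _
  have he : Epi (productHom τ) := by
    have : ∀ U, Epi ((productHom τ).hom.app U) := fun U => by
      rw [AddCommGrpCat.epi_iff_surjective]
      intro f
      refine ⟨(⟨fun x => ((show (circleFunctions τ).sections _ from f).1 x, 0),
        (show (circleFunctions τ).sections _ from f).2, zero_mem _⟩ :
        (circleFunctions τ).prod.sections U.unop.toOpens), ?_⟩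
      exact Subtype.ext (funext fun x => add_zero _)
    have : Epi (productHom τ).hom := NatTrans.epi_of_epi_app _
    exact (sheafToPresheaf _ _).epi_of_epi_map this
  have : Mono (realSequence τ).f := hm
  refine { exact := ShortComplex.exact_of_f_is_kernel _ ?_, mono_f := hm, epi_g := he }
  refine Limits.KernelFork.IsLimit.ofι' _ _ fun {T} k hk => ?_
  let fst (U : Opens M) : (circleFunctions τ).prod.sections U →+ (circleFunctions τ).sections U :=
    AddMonoidHom.mk' (fun f => ⟨fun x => (f.1 x).1, f.2.1⟩) fun _ _ => rfl
  have hsnd : ∀ (U : (EqOpens τ)ᵒᵖ) (t : T.obj.obj U) (x : U.unop.toOpens),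
      ((k.hom.app U t : (circleFunctions τ).prod.sections U.unop.toOpens).1 x).2 =
        -((k.hom.app U t : (circleFunctions τ).prod.sections U.unop.toOpens).1 x).1 := by
    intro U t x
    have h1 := congrArg (fun q : T ⟶ unitary τ =>
      ((q.hom.app U t : (circleFunctions τ).sections U.unop.toOpens)).1 x) hk
    exact eq_neg_of_add_eq_zero_right h1
  have hact : ∀ (g : ZMod 2) (p : Additive Circle × Additive Circle), p.2 = -p.1 →
      (coeffAct (circleFunctions τ).induced.σ g p).1 =
        coeffAct (circleFunctions τ).inverted.σ g p.1 := by
    intro g p hp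
    unfold coeffAct
    split_ifs
    · rfl
    · exact hp
  let l : T ⟶ unitaryBar τ := ObjectProperty.homMk
    { app := fun U => k.hom.app U ≫ AddCommGrpCat.ofHom (fst U.unop.toOpens)
      naturality := fun U V j => by
        refine ConcreteCategory.hom_ext _ _ fun t => Subtype.ext (funext fun x => ?_)
        have h1 := congrArg (fun f : (circleFunctions τ).prod.sections V.unop.toOpens => (f.1 x).1)
          (naturality_apply' k.hom j t)
        exact h1.trans (hact _ _ (hsnd U t _)) }
  refine ⟨l, ?_⟩
  ext U t
  exact Subtype.ext (funext fun x => Prod.ext rfl (hsnd U t x).symm)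

end RealSequence

section ConstantSheaf

variable {C D : Type u} [SmallCategory C] [SmallCategory D] {J : GrothendieckTopology C}
  {K : GrothendieckTopology D} (G : C ⥤ D) [G.IsContinuous J K]

lemma constComparison_toSheafify (A : AddCommGrpCat.{u}) (U : Cᵒᵖ) (a : A) :
    (constComparison (J := J) (K := K) G A).hom.app U
      ((toSheafify J ((Functor.const Cᵒᵖ).obj A)).app U a) =
      (toSheafify K ((Functor.const Dᵒᵖ).obj A)).app (G.op.obj U) a := by
  have h : toSheafify J ((Functor.const Cᵒᵖ).obj A) ≫
      (constComparison (J := J) (K := K) G A).hom =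
      Functor.whiskerLeft G.op (toSheafify K ((Functor.const Dᵒᵖ).obj A)) :=
    (Adjunction.homEquiv_unit _ _ _ _).symm.trans
      (((sheafificationAdjunction J AddCommGrpCat.{u}).homEquiv _ _).apply_symm_apply _)
  exact ConcreteCategory.congr_hom (NatTrans.congr_app h U) a

lemma constantSheaf_hom_ext {A : AddCommGrpCat.{u}} {F : Sheaf J AddCommGrpCat.{u}}
    {f g : (constantSheaf J AddCommGrpCat.{u}).obj A ⟶ F}
    (h : ∀ (U : Cᵒᵖ) (a : A), f.hom.app U ((toSheafify J ((Functor.const Cᵒᵖ).obj A)).app U a) =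
      g.hom.app U ((toSheafify J ((Functor.const Cᵒᵖ).obj A)).app U a)) : f = g := by
  refine Sheaf.hom_ext (sheafify_hom_ext _ _ _ F.property ?_)
  refine NatTrans.ext (funext fun U => ConcreteCategory.hom_ext _ _ fun a => ?_)
  exact h U a

end ConstantSheaf

section TauStar

variable {E : Type*} [NormedAddCommGroup E] [NormedSpace ℝ E]
  {H : Type*} [TopologicalSpace H] {I : ModelWithCorners ℝ E H}
  {M : Type u} [TopologicalSpace M] [ChartedSpace H M] {τ : SmoothInvolution I M}

lemma cohomologyRestrict_map {C D : Type u} [SmallCategory C] [SmallCategory D]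
    {J : GrothendieckTopology C} {K : GrothendieckTopology D} (G : C ⥤ D) [G.IsContinuous J K]
    [Limits.PreservesFiniteLimits (G.sheafPushforwardContinuous AddCommGrpCat.{u} J K)]
    [Limits.PreservesFiniteColimits (G.sheafPushforwardContinuous AddCommGrpCat.{u} J K)]
    {F F' : Sheaf K AddCommGrpCat.{u}} (f : F ⟶ F') (n : ℕ) (x : Sheaf.H F n) :
    cohomologyRestrict (J := J) G F' n (Sheaf.H.map f n x) =
      Sheaf.H.map ((G.sheafPushforwardContinuous AddCommGrpCat.{u} J K).map f) n
        (cohomologyRestrict (J := J) G F n x) := by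
  change (Ext.mk₀ _).comp ((x.comp (Ext.mk₀ f) (add_zero n)).mapExactFunctor _) (zero_add n) =
    ((Ext.mk₀ _).comp (x.mapExactFunctor _) (zero_add n)).comp (Ext.mk₀ _) (add_zero n)
  rw [Ext.mapExactFunctor_comp, Ext.mapExactFunctor_mk₀, Ext.comp_assoc_of_third_deg_zero]

variable (τ) in
/-- The action of the nontrivial element of `ℤ/2` as a natural transformation. -/
def actionNatTrans : forgetAction τ ⋙ directImage τ ⟶ forgetAction τ where
  app := actionHom
  naturality F G f := by
    ext U s
    exact (naturality_apply' f.hom _ _).symm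

lemma constComparison_actionHom (A : AddCommGrpCat.{u}) :
    constComparison (J := Opens.grothendieckTopology M) (K := Opens.grothendieckTopology M)
      (preimageFunctor τ) A ≫ (directImage τ).map (constComparison (J := Opens.grothendieckTopology M)
        (K := EqOpens.topology τ) (EqOpens.incl τ) A) ≫ actionHom _ =
      constComparison (EqOpens.incl τ) A := by
  refine constantSheaf_hom_ext fun U a => ?_
  rw [constComparison_toSheafify]
  change ((constantSheaf (EqOpens.topology τ) AddCommGrpCat.{u}).obj A).obj.map
    (EqOpens.flip U.unop).op ((constComparison (EqOpens.incl τ) A).hom.app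
      (op ((preimageFunctor τ).obj U.unop))
      ((constComparison (J := Opens.grothendieckTopology M) (K := Opens.grothendieckTopology M)
        (preimageFunctor τ) A).hom.app U _)) = _
  rw [constComparison_toSheafify (preimageFunctor τ) A U a]
  refine (congrArg _ (constComparison_toSheafify (EqOpens.incl τ) A _ a)).trans ?_
  exact (naturality_apply' (toSheafify (EqOpens.topology τ) ((Functor.const _).obj A))
    (EqOpens.flip U.unop).op a).symm

lemma tauStar_forgetEquivariance (F : Z2Sheaf τ) (n : ℕ) (x : EqCohomology F n) :
    tauStar F n (forgetEquivariance F n x) = forgetEquivariance F n x := by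
  have : Limits.PreservesFiniteLimits (forgetAction τ ⋙ directImage τ) :=
    Limits.comp_preservesFiniteLimits _ _
  have : Limits.PreservesFiniteColimits (forgetAction τ ⋙ directImage τ) :=
    Limits.comp_preservesFiniteColimits _ _
  have h := mapExactFunctor_naturality (actionNatTrans τ) x
  rw [← mapExactFunctor_mapExactFunctor] at h
  let A := AddCommGrpCat.of (ULift.{u} ℤ)
  let c : (constantSheaf (Opens.grothendieckTopology M) AddCommGrpCat.{u}).obj A ⟶ _ :=
    constComparison (J := Opens.grothendieckTopology M) (K := EqOpens.topology τ) (EqOpens.incl τ) A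
  let d : (constantSheaf (Opens.grothendieckTopology M) AddCommGrpCat.{u}).obj A ⟶ _ :=
    constComparison (J := Opens.grothendieckTopology M) (K := Opens.grothendieckTopology M)
      (preimageFunctor τ) A
  change ((Ext.mk₀ d).comp (((Ext.mk₀ c).comp (x.mapExactFunctor (forgetAction τ))
    (zero_add n)).mapExactFunctor (directImage τ)) (zero_add n)).comp (Ext.mk₀ (actionHom F))
      (add_zero n) = (Ext.mk₀ c).comp (x.mapExactFunctor (forgetAction τ)) (zero_add n)
  rw [Ext.mapExactFunctor_comp, Ext.mapExactFunctor_mk₀, Ext.comp_assoc_of_third_deg_zero,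
    Ext.comp_assoc_of_third_deg_zero]
  refine (congrArg (fun z => (Ext.mk₀ d).comp ((Ext.mk₀ ((directImage τ).map c)).comp z
    (zero_add n)) (zero_add n)) h).trans ?_
  refine (Ext.mk₀_comp_mk₀_assoc _ _ _).trans ((Ext.mk₀_comp_mk₀_assoc _ _ _).trans ?_)
  refine congrArg (fun z => (Ext.mk₀ z).comp (x.mapExactFunctor (forgetAction τ)) (zero_add n)) ?_
  exact (Category.assoc _ _ _).trans (constComparison_actionHom A)

/-- The involution `τ*` commutes with connecting homomorphisms. -/
lemma tauStar_connecting {S : ShortComplex (Z2Sheaf τ)} (hS : S.ShortExact) (n : ℕ)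
    (x : Cohomology S.X₃ n) :
    tauStar S.X₁ (n + 1) (connecting (hS.map_of_exact (forgetAction τ)) n x) =
      connecting (hS.map_of_exact (forgetAction τ)) n (tauStar S.X₃ n x) := by
  let hS₁ := hS.map_of_exact (forgetAction τ)
  have h := ShortComplex.ShortExact.extClass_naturality (hS₁.map_of_exact (directImage τ)) hS₁
    (S.mapNatTrans (actionNatTrans τ))
  rw [← Ext.mapExactFunctor_extClass _ hS₁] at h
  let ε : Ext ((forgetAction τ).obj S.X₃) ((forgetAction τ).obj S.X₁) 1 := hS₁.extClass
  have h' : (ε.mapExactFunctor (directImage τ)).comp (Ext.mk₀ (actionHom S.X₁)) (add_zero 1) =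
      (Ext.mk₀ (actionHom S.X₃)).comp ε (zero_add 1) := h
  let d : (constantSheaf (Opens.grothendieckTopology M) AddCommGrpCat.{u}).obj
      (AddCommGrpCat.of (ULift.{u} ℤ)) ⟶ _ :=
    constComparison (J := Opens.grothendieckTopology M) (K := Opens.grothendieckTopology M)
      (preimageFunctor τ) (AddCommGrpCat.of (ULift.{u} ℤ))
  change ((Ext.mk₀ d).comp ((x.comp ε rfl).mapExactFunctor (directImage τ)) (zero_add _)).comp
    (Ext.mk₀ (actionHom S.X₁)) (add_zero _) = (((Ext.mk₀ d).comp
      (x.mapExactFunctor (directImage τ)) (zero_add n)).comp (Ext.mk₀ (actionHom S.X₃))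
        (add_zero n)).comp ε rfl
  rw [Ext.mapExactFunctor_comp, Ext.comp_assoc_of_third_deg_zero, Ext.comp_assoc_of_third_deg_zero,
    h', Ext.comp_assoc_of_second_deg_zero, Ext.comp_assoc _ _ _ (zero_add n) rfl (by omega)]

lemma tauStar_map_of_anticommute {F G : Z2Sheaf τ}
    (j : (forgetAction τ).obj F ⟶ (forgetAction τ).obj G)
    (hj : (directImage τ).map j ≫ actionHom G = -(actionHom F ≫ j)) (n : ℕ) (x : Cohomology F n) :
    tauStar G n (Sheaf.H.map j n x) = -Sheaf.H.map j n (tauStar F n x) := by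
  refine (congrArg (Sheaf.H.map (actionHom G) n)
    (cohomologyRestrict_map (preimageFunctor τ) j n x)).trans ?_
  refine (Sheaf.H.map_comp_apply _ _ _).symm.trans ?_
  rw [hj]
  refine (Sheaf.H.map_apply _ _).trans ?_
  rw [Ext.mk₀_neg, Ext.comp_neg]
  exact congrArg Neg.neg (Sheaf.H.map_comp_apply (actionHom F) j _)

variable (τ) in
/-- The identification of the underlying sheaves of `U(1)-bar` and `𝒰(1)`. -/
def barToUnitary : (forgetAction τ).obj (unitaryBar τ) ⟶ (forgetAction τ).obj (unitary τ) :=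
  Coefficients.Hom.toSheafHom (S := (circleFunctions τ).inverted)
    (T := (circleFunctions τ).trivial) { toHom := AddMonoidHom.id _, comp_mem := fun hf => hf }

lemma barToUnitary_actionHom :
    (directImage τ).map (barToUnitary τ) ≫ actionHom (unitary τ) =
      -(actionHom (unitaryBar τ) ≫ barToUnitary τ) := by
  ext U s
  exact Subtype.ext (funext fun x => (neg_neg _).symm)

lemma tauStar_forgetReal (n : ℕ) (x : EqCohomology (unitaryBar τ) n) :
    tauStar (unitary τ) n (forgetReal τ n x) = -forgetReal τ n x :=
  (tauStar_map_of_anticommute (barToUnitary τ) barToUnitary_actionHom n _).trans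
    (congrArg (fun y => -Sheaf.H.map (barToUnitary τ) n y) (tauStar_forgetEquivariance _ n x))

lemma firstSummand_antidiagonal (n : ℕ) (x : EqCohomology (unitaryBar τ) n) :
    firstSummand τ n (Sheaf.H.map (antidiagonalHom τ) n x) = forgetReal τ n x :=
  (congrArg (Sheaf.H.map (circleFunctions τ).fst n)
    (cohomologyRestrict_map (EqOpens.incl τ) (antidiagonalHom τ) n x)).trans
    (Sheaf.H.map_comp_apply _ _ _).symm

end TauStar

end RealGerbe

theorem mainTheorem8 {E : Type*} [NormedAddCommGroup E] [NormedSpace ℝ E] [FiniteDimensional ℝ E]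
    {H : Type*} [TopologicalSpace H] (I : ModelWithCorners ℝ E H)
    (M : Type u) [TopologicalSpace M] [ChartedSpace H M] [IsManifold I ∞ M]
    [T2Space M] [SigmaCompactSpace M] (τ : RealGerbe.SmoothInvolution I M) :
    ∃ (φ : RealGerbe.Cohomology (RealGerbe.unitary τ) 2 ≃+
          RealGerbe.Cohomology (RealGerbe.integers τ) 3)
      (ψ : RealGerbe.EqCohomology (RealGerbe.unitary τ) 2 ≃+
          RealGerbe.EqCohomology (RealGerbe.integers τ) 3)
      (e : RealGerbe.EqCohomology (RealGerbe.unitaryInduced τ) 2 ≃+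
          RealGerbe.Cohomology (RealGerbe.unitary τ) 2),
      (∀ c, φ c = RealGerbe.bockstein τ 2 c) ∧
      (∀ c, ψ c = RealGerbe.eqBockstein τ 2 c) ∧
      (∀ c, e c = RealGerbe.firstSummand τ 2 c) ∧
      ∀ h : RealGerbe.Cohomology (RealGerbe.integers τ) 3,
        (RealGerbe.IsOrientifoldFlux τ h ↔
          RealGerbe.productMap τ 2 (e.symm (φ.symm h)) = 0) ∧
        (RealGerbe.IsOrientifoldFlux τ h ↔
          ψ (RealGerbe.productMap τ 2 (e.symm (φ.symm h))) = 0) := by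
  have he : Function.Bijective (RealGerbe.firstSummand τ 2) :=
    (RealGerbe.circleFunctions τ).bijective_fst_forgetEquivariance 2
  let φ := AddEquiv.ofBijective _ (RealGerbe.bijective_bockstein τ 1)
  let ψ := AddEquiv.ofBijective _ (RealGerbe.bijective_eqBockstein τ 1)
  let e := AddEquiv.ofBijective _ he
  have key : ∀ h, RealGerbe.IsOrientifoldFlux τ h ↔
      RealGerbe.productMap τ 2 (e.symm (φ.symm h)) = 0 := by
    intro h
    constructor
    · rintro ⟨-, x, hx⟩
      have h1 : e.symm (φ.symm h) = Sheaf.H.map (RealGerbe.antidiagonalHom τ) 2 x := by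
        rw [AddEquiv.symm_apply_eq, AddEquiv.symm_apply_eq]
        exact hx.symm.trans
          (congrArg (RealGerbe.bockstein τ 2) (RealGerbe.firstSummand_antidiagonal 2 x).symm)
      rw [h1]
      exact (RealGerbe.map_eq_zero_iff_exists RealGerbe.realSequence_shortExact 2 _).2 ⟨x, rfl⟩
    · intro h0
      obtain ⟨x, hx⟩ : ∃ x : RealGerbe.EqCohomology (RealGerbe.unitaryBar τ) 2,
          Sheaf.H.map (RealGerbe.antidiagonalHom τ) 2 x = e.symm (φ.symm h) :=
        (RealGerbe.map_eq_zero_iff_exists (RealGerbe.realSequence_shortExact (τ := τ)) 2 _).1 h0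
      have h1 : RealGerbe.bockstein τ 2 (RealGerbe.forgetReal τ 2 x) = h := by
        rw [← RealGerbe.firstSummand_antidiagonal 2 x]
        refine (congrArg (fun y => φ (e y)) hx).trans ?_
        rw [AddEquiv.apply_symm_apply, AddEquiv.apply_symm_apply]
      refine ⟨?_, x, h1⟩
      have h2 : RealGerbe.tauStar (RealGerbe.integers τ) 3
          (RealGerbe.bockstein τ 2 (RealGerbe.forgetReal τ 2 x)) =
          RealGerbe.bockstein τ 2 (RealGerbe.tauStar (RealGerbe.unitary τ) 2
            (RealGerbe.forgetReal τ 2 x)) :=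
        RealGerbe.tauStar_connecting RealGerbe.exponentialSequence_shortExact 2 _
      rw [← h1, h2, RealGerbe.tauStar_forgetReal 2 x, map_neg, add_neg_cancel]
  exact ⟨φ, ψ, e, fun _ => rfl, fun _ => rfl, fun _ => rfl, fun h => ⟨key h, (key h).trans
    (map_eq_zero_iff ψ ψ.injective).symm⟩⟩

end
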